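/- Let $(M,g)$ be a connected, complete, non-compact smooth Riemannian manifold (without boundary) of dimension $n\ge 2$, with gradient $\nabla$ and volume measure $dV$, and let $\mu>0$ be a real number. Let $\rho:M\to[0,+\infty)$ be a locally Lipschitz function such that - $\rho$ is an exhaustion function: $B_r:=\{x\in M:\rho(x)<r\}$ is relatively compact in $M$ for every $r>0$; - $|\nabla\rho|\le 1$ almost everywhere on $M$; - $\Delta\rho^2\ge 2\mu$ in the sense of distributions, i.e. $\displaystyle\int_M\langle\nabla\rho^2,\nabla\varphi\rangle\,dV\le-\int_M 2\mu\,\varphi\,dV$ for every nonnegative $\varphi\in C_0^\infty(M)$. For a relatively compact open set $\Omega\subset M$ let $$\lambda_1(\Omega):=\inf\left\{\frac{\int_\Omega|\nabla\phi|^2\,dV}{\int_\Omega\phi^2\,dV}:\ \phi \text{ Lipschitz on } M \text{ with compact support},\ \operatorname{supp}\phi\subset\overline{\Omega},\ \phi\not\equiv0\right\},$$ with $\lambda_1(\varnothing)=+\infty$, and let $$\lambda_\mu:=\inf\left\{\frac{\int_0^1|\psi'(s)|^2s^{\mu-1}\,ds}{\int_0^1|\psi(s)|^2s^{\mu-1}\,ds}:\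 \psi\in\mathrm{Lip}([0,1]),\ \psi(1)=0,\ \psi\not\equiv0\right\}.$$ Then $$\lambda_1(B_r)\ \ge\ \frac{\lambda_\mu}{r^2}\qquad\text{for every } r>0.$$ -/

import Mathlib

open scoped Manifold ContDiff Bundle ENNReal
open MeasureTheory Bundle

noncomputable section

section Riemannian

variable {n : ℕ} {M : Type*} [MetricSpace M] [ChartedSpace (EuclideanSpace ℝ (Fin n)) M]
  [RiemannianBundle (fun x : M ↦ TangentSpace (𝓡 n) x)]

/-- The tangent spaces, with the norm given by the Riemannian metric, are complete, being
finite-dimensional. -/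
theorem completeSpace_tangentSpace (x : M) : CompleteSpace (TangentSpace (𝓡 n) x) := by
  have : FiniteDimensional ℝ (TangentSpace (𝓡 n) x) :=
    inferInstanceAs (FiniteDimensional ℝ (EuclideanSpace ℝ (Fin n)))
  exact FiniteDimensional.complete ℝ _

/-- The Riemannian gradient `∇f(x)`: the tangent vector at `x` which represents the differential
of `f` at `x` through the metric. At points where `f` is not differentiable (a null set if `f` is
locally Lipschitz) it is zero by convention. -/
def riemannianGrad (n : ℕ) {M : Type*} [MetricSpace M]
    [ChartedSpace (EuclideanSpace ℝ (Fin n)) M]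
    [RiemannianBundle (fun x : M ↦ TangentSpace (𝓡 n) x)]
    (f : M → ℝ) (x : M) : TangentSpace (𝓡 n) x :=
  have := completeSpace_tangentSpace (n := n) x
  (InnerProductSpace.toDual ℝ (TangentSpace (𝓡 n) x)).symm
    (mfderiv (𝓡 n) 𝓘(ℝ, ℝ) f x : TangentSpace (𝓡 n) x →L[ℝ] ℝ)

/-- The vector field `∂/∂yᵢ` of the chart around `x`, at the point of `M` with coordinates `y`. -/
def coordVector (x : M) (y : EuclideanSpace ℝ (Fin n)) (i : Fin n) :
    TangentSpace (𝓡 n) ((extChartAt (𝓡 n) x).symm y) :=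
  (mfderiv (𝓡 n) (𝓡 n) (extChartAt (𝓡 n) x).symm y :
      EuclideanSpace ℝ (Fin n) →L[ℝ] TangentSpace (𝓡 n) ((extChartAt (𝓡 n) x).symm y))
    (EuclideanSpace.single i (1 : ℝ))

/-- `√(det (gᵢⱼ))` in the chart around `x`, where `gᵢⱼ = ⟨∂/∂yᵢ, ∂/∂yⱼ⟩`. -/
def volumeDensity (x : M) (y : EuclideanSpace ℝ (Fin n)) : ℝ :=
  Real.sqrt (Matrix.det (Matrix.of fun i j : Fin n ↦
    inner ℝ (coordVector (n := n) x y i) (coordVector (n := n) x y j)))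

/-- The measure `√(det (gᵢⱼ)) dy` of the chart around `x`, carried to `M`. It lives on the domain
of that chart. -/
def chartVolume [MeasurableSpace M] (x : M) : Measure M :=
  Measure.map (extChartAt (𝓡 n) x).symm
    ((volume.restrict (extChartAt (𝓡 n) x).target).withDensity
      fun y ↦ ENNReal.ofReal (volumeDensity (n := n) x y))

/-- The Riemannian volume measure `dV`. The measures `√(det (gᵢⱼ)) dy` of any two charts agree
where both charts are defined; their supremum is the measure that restricts to each of them. -/
def riemannianVolume (n : ℕ) (M : Type*) [MetricSpace M]
    [ChartedSpace (EuclideanSpace ℝ (Fin n)) M]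
    [RiemannianBundle (fun x : M ↦ TangentSpace (𝓡 n) x)] [MeasurableSpace M] : Measure M :=
  ⨆ x : M, chartVolume (n := n) x

/-- `Δw ≥ v` in the sense of distributions, for `w` locally Lipschitz and `v` locally integrable:
`∫ ⟨∇w, ∇φ⟩ dV ≤ -∫ v φ dV` for every nonnegative smooth `φ` with compact support. -/
def WeakLaplacianGE (n : ℕ) {M : Type*} [MetricSpace M]
    [ChartedSpace (EuclideanSpace ℝ (Fin n)) M]
    [RiemannianBundle (fun x : M ↦ TangentSpace (𝓡 n) x)] [MeasurableSpace M]
    (w v : M → ℝ) : Prop :=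
  ∀ φ : M → ℝ, ContMDiff (𝓡 n) 𝓘(ℝ, ℝ) ∞ φ → HasCompactSupport φ → (∀ x, 0 ≤ φ x) →
    ∫ x, inner ℝ (riemannianGrad n w x) (riemannianGrad n φ x) ∂(riemannianVolume n M)
      ≤ -∫ x, v x * φ x ∂(riemannianVolume n M)

/-- The first Dirichlet eigenvalue `λ₁(Ω)` of a relatively compact open set `Ω`: the infimum of
`∫_Ω |∇φ|² dV / ∫_Ω φ² dV` over the Lipschitz functions `φ ≢ 0` on `M` with compact support
contained in the closure of `Ω`. In particular `λ₁(∅) = ∞`. -/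
def firstDirichletEigenvalue (n : ℕ) {M : Type*} [MetricSpace M]
    [ChartedSpace (EuclideanSpace ℝ (Fin n)) M]
    [RiemannianBundle (fun x : M ↦ TangentSpace (𝓡 n) x)] [MeasurableSpace M]
    (Ω : Set M) : ℝ≥0∞ :=
  ⨅ (φ : M → ℝ) (_ : ∃ K, LipschitzWith K φ) (_ : HasCompactSupport φ)
    (_ : tsupport φ ⊆ closure Ω) (_ : ∃ x, φ x ≠ 0),
    (∫⁻ x in Ω, ‖riemannianGrad n φ x‖ₑ ^ 2 ∂(riemannianVolume n M)) /
      (∫⁻ x in Ω, ‖φ x‖ₑ ^ 2 ∂(riemannianVolume n M))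

end Riemannian

/-- The first eigenvalue `λ_μ` on `[0,1)` for the measure `s^(μ-1) ds` and the Dirichlet condition
at `s = 1`. -/
def modelEigenvalue (μ : ℝ) : ℝ :=
  sInf {q : ℝ | ∃ ψ : ℝ → ℝ, (∃ K, LipschitzOnWith K ψ (Set.Icc 0 1)) ∧ ψ 1 = 0 ∧
    (∃ s ∈ Set.Icc (0 : ℝ) 1, ψ s ≠ 0) ∧
    q = (∫ s in (0 : ℝ)..1, |deriv ψ s| ^ 2 * s ^ (μ - 1)) /
      (∫ s in (0 : ℝ)..1, |ψ s| ^ 2 * s ^ (μ - 1))}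

end

/-! The argument is Barta's, carried out weakly. Put `w = ρ²`. For `0 < λ < λ_μ` the radial model
equation `u'' + (μ-1)/s · u' = -(λ/r²) u` has the regular solution `u(s) = F(s²)`, where `4tF'' +
2μF' = -(λ/r²)F` and `F` is a rescaled series `₀F₁(; μ/2; ·)`. A zero of `u` in `[0, r]` would,
after rescaling, give a competitor for `λ_μ` of quotient at most `λ`, so `F > 0` on `[0, r²]`.
Differentiation only shifts the parameter of the series, which yields `F' ≤ 0` and `F'' ≥ 0`.

Formally `F(w)` is a positive supersolution: `Δw ≥ 2μ` is multiplied by `F' ≤ 0`, and `|∇w|² ≤ 4w`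
by `F'' ≥ 0`. Weakly, the inequality is tested with `φ² g(w)`, `g = -F'/F ≥ 0`, and `|∇φ + φ g ∇w|²
≥ 0` gives `λ/r² ∫ φ² ≤ ∫ |∇φ|²` (`WeakLaplacianGE.integral_sq_le`). Then `λ` increases to `λ_μ`.

Two points need work. The test function is only Lipschitz, so the distributional inequality is
extended by a partition of unity and mollification in charts (`WeakLaplacianGE.integral_le`); this
rests on the description of the volume and of gradients in coordinates. Moreover `φ` is supported in
the closure of `B_r` while the quotient integrates over `B_r`: the weights `exp (k (w - r²))` show
that `φ = 0` almost everywhere on `{ρ = r}` (`WeakLaplacianGE.ae_eq_zero_of_isMax`). -/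

set_option linter.unusedSectionVars false

/-! ### Gradients in local coordinates. -/

section ChartCalculus

open Set Filter Topology

variable {n : ℕ} {M : Type*} [MetricSpace M] [ChartedSpace (EuclideanSpace ℝ (Fin n)) M]
  [RiemannianBundle (fun x : M ↦ TangentSpace (𝓡 n) x)]

/-- The Gram matrix of the coordinate vector fields of the chart around `x`. -/
noncomputable def chartGram (x : M) (y : EuclideanSpace ℝ (Fin n)) : Matrix (Fin n) (Fin n) ℝ :=
  Matrix.gram ℝ (coordVector (n := n) x y)

theorem volumeDensity_eq (x : M) (y : EuclideanSpace ℝ (Fin n)) :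
    volumeDensity (n := n) x y = Real.sqrt (chartGram x y).det := rfl

/-- The partial derivatives at `y` of a function on `M` read in the chart around `x`. -/
noncomputable def chartDeriv (x : M) (f : M → ℝ) (y : EuclideanSpace ℝ (Fin n)) : Fin n → ℝ :=
  fun i ↦ fderiv ℝ (f ∘ (extChartAt (𝓡 n) x).symm) y (EuclideanSpace.single i 1)

theorem chart_symm_mem_source (x : M) {y : EuclideanSpace ℝ (Fin n)}
    (hy : y ∈ (extChartAt (𝓡 n) x).target) :
    (extChartAt (𝓡 n) x).symm y ∈ (chartAt (EuclideanSpace ℝ (Fin n)) x).source := by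
  rw [← extChartAt_source (I := 𝓡 n)]
  exact (extChartAt (𝓡 n) x).map_target hy

section Smooth

variable [IsManifold (𝓡 n) ∞ M]

theorem mdifferentiableAt_chart_symm (x : M) {y : EuclideanSpace ℝ (Fin n)}
    (hy : y ∈ (extChartAt (𝓡 n) x).target) :
    MDifferentiableAt (𝓡 n) (𝓡 n) (extChartAt (𝓡 n) x).symm y := by
  have := mdifferentiableWithinAt_extChartAt_symm (I := 𝓡 n) hy
  rwa [ModelWithCorners.Boundaryless.range_eq_univ, mdifferentiableWithinAt_univ] at this

theorem isInvertible_mfderiv_chart_symm (x : M) {y : EuclideanSpace ℝ (Fin n)}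
    (hy : y ∈ (extChartAt (𝓡 n) x).target) :
    (mfderiv (𝓡 n) (𝓡 n) (extChartAt (𝓡 n) x).symm y).IsInvertible := by
  have := isInvertible_mfderivWithin_extChartAt_symm (I := 𝓡 n) hy
  rwa [ModelWithCorners.Boundaryless.range_eq_univ, mfderivWithin_univ] at this

theorem mdifferentiableAt_iff_chart (x : M) {y : EuclideanSpace ℝ (Fin n)}
    (hy : y ∈ (extChartAt (𝓡 n) x).target) (f : M → ℝ) :
    MDifferentiableAt (𝓡 n) 𝓘(ℝ, ℝ) f ((extChartAt (𝓡 n) x).symm y) ↔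
      DifferentiableAt ℝ (f ∘ (extChartAt (𝓡 n) x).symm) y := by
  rw [← mdifferentiableAt_iff_differentiableAt]
  refine ⟨fun h ↦ h.comp y (mdifferentiableAt_chart_symm x hy), fun h ↦ ?_⟩
  have hs := chart_symm_mem_source x hy
  have h1 : MDifferentiableAt (𝓡 n) 𝓘(ℝ, ℝ)
      ((f ∘ (extChartAt (𝓡 n) x).symm) ∘ extChartAt (𝓡 n) x) ((extChartAt (𝓡 n) x).symm y) := by
    refine MDifferentiableAt.comp (I' := 𝓘(ℝ, EuclideanSpace ℝ (Fin n))) _ ?_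
      (mdifferentiableAt_extChartAt hs)
    rwa [(extChartAt (𝓡 n) x).right_inv hy]
  refine h1.congr_of_eventuallyEq ?_
  filter_upwards [extChartAt_source_mem_nhds' (I := 𝓡 n) (x := x)
    (by rw [extChartAt_source]; exact hs)] with z hz
  exact congrArg f ((extChartAt (𝓡 n) x).left_inv hz).symm

/-- Differentiability on `M` and in the chart are equivalent, and both derivatives default to zero
otherwise. Hence the coordinate formulas need no hypothesis on `f`. -/
theorem mfderiv_coordVector (x : M) {y : EuclideanSpace ℝ (Fin n)}
    (hy : y ∈ (extChartAt (𝓡 n) x).target) (f : M → ℝ) (i : Fin n) :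
    (mfderiv (𝓡 n) 𝓘(ℝ, ℝ) f ((extChartAt (𝓡 n) x).symm y) (coordVector x y i) : ℝ) =
      chartDeriv x f y i := by
  by_cases h : MDifferentiableAt (𝓡 n) 𝓘(ℝ, ℝ) f ((extChartAt (𝓡 n) x).symm y)
  · have := mfderiv_comp y h (mdifferentiableAt_chart_symm x hy)
    rw [mfderiv_eq_fderiv] at this
    unfold chartDeriv
    rw [this]
    rfl
  · have h' := mt (mdifferentiableAt_iff_chart x hy f).2 h
    rw [mfderiv_zero_of_not_mdifferentiableAt h]
    unfold chartDeriv
    rw [fderiv_zero_of_not_differentiableAt h']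
    rfl

theorem linearIndependent_coordVector (x : M) {y : EuclideanSpace ℝ (Fin n)}
    (hy : y ∈ (extChartAt (𝓡 n) x).target) :
    LinearIndependent ℝ (coordVector (n := n) x y) := by
  obtain ⟨e, he⟩ := isInvertible_mfderiv_chart_symm x hy
  have h1 : LinearIndependent ℝ fun i : Fin n ↦ EuclideanSpace.single i (1 : ℝ) := by
    have := (EuclideanSpace.basisFun (Fin n) ℝ).toBasis.linearIndependent
    have heq : (fun i : Fin n ↦ EuclideanSpace.single i (1 : ℝ)) =
        (EuclideanSpace.basisFun (Fin n) ℝ).toBasis := by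
      ext1 i
      simp
    rw [heq]
    exact this
  let e' : EuclideanSpace ℝ (Fin n) ≃ₗ[ℝ]
    TangentSpace (𝓡 n) ((extChartAt (𝓡 n) x).symm y) := e.toLinearEquiv
  have h2 := h1.map' e'.toLinearMap e'.ker
  convert! h2 using 1
  ext1 i
  unfold coordVector
  rw [← he]
  rfl

theorem posDef_chartGram (x : M) {y : EuclideanSpace ℝ (Fin n)}
    (hy : y ∈ (extChartAt (𝓡 n) x).target) : (chartGram (n := n) x y).PosDef :=
  Matrix.posDef_gram_of_linearIndependent (linearIndependent_coordVector x hy)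

theorem inner_riemannianGrad_left (f : M → ℝ) (p : M) (v : TangentSpace (𝓡 n) p) :
    inner ℝ (riemannianGrad n f p) v = (mfderiv (𝓡 n) 𝓘(ℝ, ℝ) f p v : ℝ) := by
  have := completeSpace_tangentSpace (n := n) p
  unfold riemannianGrad
  exact InnerProductSpace.toDual_symm_apply

-- Write `∇h = ∑ aⱼ ∂ⱼ`. Pairing with `∂ᵢ` gives `G a = dh`, so `a = G⁻¹ dh`, and `⟨∇f, ∇h⟩ = df ·
-- a`.
open Matrix in
theorem inner_riemannianGrad_chart (x : M) {y : EuclideanSpace ℝ (Fin n)}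
    (hy : y ∈ (extChartAt (𝓡 n) x).target) (f h : M → ℝ) :
    inner ℝ (riemannianGrad n f ((extChartAt (𝓡 n) x).symm y))
      (riemannianGrad n h ((extChartAt (𝓡 n) x).symm y)) =
      chartDeriv x f y ⬝ᵥ (chartGram x y)⁻¹ *ᵥ chartDeriv x h y := by
  have hli := linearIndependent_coordVector x hy
  have hcard : Fintype.card (Fin n) =
      Module.finrank ℝ (TangentSpace (𝓡 n) ((extChartAt (𝓡 n) x).symm y)) := by
    change _ = Module.finrank ℝ (EuclideanSpace ℝ (Fin n))
    simp
  -- Dimension zero is separate because the basis built below needs a nonempty index type.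
  rcases Nat.eq_zero_or_pos n with hn | hn
  · subst hn
    have : Subsingleton (TangentSpace (𝓡 0) ((extChartAt (𝓡 0) x).symm y)) :=
      inferInstanceAs (Subsingleton (EuclideanSpace ℝ (Fin 0)))
    rw [Subsingleton.elim (riemannianGrad 0 f ((extChartAt (𝓡 0) x).symm y)) 0]
    rw [inner_zero_left]
    simp [dotProduct]
  have : Nonempty (Fin n) := ⟨⟨0, hn⟩⟩
  let b := basisOfLinearIndependentOfCardEqFinrank hli hcard
  have hb : ∀ i, b i = coordVector x y i := fun i ↦ by
    rw [coe_basisOfLinearIndependentOfCardEqFinrank]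
  set a : Fin n → ℝ := fun i ↦ b.repr (riemannianGrad n h ((extChartAt (𝓡 n) x).symm y)) i with ha
  have hsum : riemannianGrad n h ((extChartAt (𝓡 n) x).symm y) = ∑ i, a i • coordVector x y i := by
    conv_lhs => rw [← b.sum_repr (riemannianGrad n h ((extChartAt (𝓡 n) x).symm y))]
    exact Finset.sum_congr rfl fun i _ ↦ by rw [hb]
  have hGa : chartGram x y *ᵥ a = chartDeriv x h y := by
    ext i
    rw [← mfderiv_coordVector x hy h i, ← inner_riemannianGrad_left, real_inner_comm, hsum, inner_sum]
    simp only [inner_smul_right, mulVec, dotProduct, chartGram, gram_apply]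
    exact Finset.sum_congr rfl fun j _ ↦ mul_comm _ _
  have hdet : IsUnit (chartGram (n := n) x y).det := (posDef_chartGram x hy).det_pos.ne'.isUnit
  rw [← hGa, mulVec_mulVec, nonsing_inv_mul _ hdet, one_mulVec, hsum, inner_sum]
  simp only [inner_smul_right, dotProduct]
  refine Finset.sum_congr rfl fun j _ ↦ ?_
  rw [inner_riemannianGrad_left, mfderiv_coordVector x hy, mul_comm]

end Smooth

end ChartCalculus

/-! ### Continuity of the metric in charts, and Lipschitz functions read in charts. -/

/-- A function on `M` is locally Lipschitz in charts if it is so for the Euclidean distance of each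
chart. -/
def LipschitzInCharts (n : ℕ) {M : Type*} [MetricSpace M]
    [ChartedSpace (EuclideanSpace ℝ (Fin n)) M] (f : M → ℝ) : Prop :=
  ∀ x : M, ∀ y ∈ (extChartAt (𝓡 n) x).target, ∃ K, ∃ s ∈ nhds y,
    LipschitzOnWith K (f ∘ (extChartAt (𝓡 n) x).symm) s

section ChartMetric

open Set Filter Topology

variable {n : ℕ} {M : Type*} [MetricSpace M] [ChartedSpace (EuclideanSpace ℝ (Fin n)) M]
  [RiemannianBundle (fun x : M ↦ TangentSpace (𝓡 n) x)]
  [IsManifold (𝓡 n) ∞ M]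

theorem isOpen_chart_target (x : M) : IsOpen (extChartAt (𝓡 n) x).target :=
  isOpen_extChartAt_target x

/-- The field `∂ᵢ` is the image of a constant field under the tangent map of the inverse chart,
which is continuous because the inverse chart is `C¹`. -/
theorem continuousOn_coordVector (x : M) (i : Fin n) :
    ContinuousOn (fun y ↦ (⟨(extChartAt (𝓡 n) x).symm y, coordVector x y i⟩ : TangentBundle (𝓡 n) M))
      (extChartAt (𝓡 n) x).target := by
  have h1 := (contMDiffOn_extChartAt_symm (I := 𝓡 n) (n := 1) x).continuousOn_tangentMapWithin
    le_rfl (isOpen_chart_target x).uniqueMDiffOn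
  have h2 : Continuous (fun y : EuclideanSpace ℝ (Fin n) ↦
      (⟨y, EuclideanSpace.single i (1 : ℝ)⟩ :
        TangentBundle (𝓘(ℝ, EuclideanSpace ℝ (Fin n))) (EuclideanSpace ℝ (Fin n)))) := by
    have h3 := (tangentBundleModelSpaceHomeomorph
      (𝓘(ℝ, EuclideanSpace ℝ (Fin n)))).symm.continuous
    exact h3.comp (continuous_id.prodMk continuous_const)
  refine (h1.comp h2.continuousOn (fun y hy ↦ hy)).congr fun y hy ↦ ?_
  simp only [Function.comp_apply, tangentMapWithin]
  rw [mfderivWithin_eq_mfderiv ((isOpen_chart_target x).uniqueMDiffWithinAt hy)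
    (mdifferentiableAt_chart_symm x hy)]
  rfl

variable [IsContinuousRiemannianBundle (EuclideanSpace ℝ (Fin n))
  (fun x : M ↦ TangentSpace (𝓡 n) x)]

theorem continuousOn_chartGram (x : M) :
    ContinuousOn (chartGram (n := n) x) (extChartAt (𝓡 n) x).target := by
  refine continuousOn_pi.2 fun i ↦ continuousOn_pi.2 fun j ↦ ?_
  exact (continuousOn_coordVector x i).inner_bundle (continuousOn_coordVector x j)

theorem continuousOn_volumeDensity (x : M) :
    ContinuousOn (volumeDensity (n := n) x) (extChartAt (𝓡 n) x).target :=
  Real.continuous_sqrt.comp_continuousOn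
    ((Continuous.matrix_det continuous_id).comp_continuousOn (continuousOn_chartGram x))

theorem continuousOn_chartGram_inv (x : M) :
    ContinuousOn (fun y ↦ (chartGram (n := n) x y)⁻¹) (extChartAt (𝓡 n) x).target := by
  simp only [Matrix.inv_def, Ring.inverse_eq_inv']
  refine ContinuousOn.smul (ContinuousOn.inv₀
    ((Continuous.matrix_det continuous_id).comp_continuousOn (continuousOn_chartGram x))
    fun y hy ↦ (posDef_chartGram x hy).det_pos.ne') ?_
  exact (Continuous.matrix_adjugate continuous_id).comp_continuousOn (continuousOn_chartGram x)

theorem volumeDensity_pos (x : M) {y : EuclideanSpace ℝ (Fin n)}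
    (hy : y ∈ (extChartAt (𝓡 n) x).target) : 0 < volumeDensity (n := n) x y := by
  rw [volumeDensity_eq]
  exact Real.sqrt_pos.2 (posDef_chartGram x hy).det_pos

theorem continuousOn_norm_coordVector (x : M) (i : Fin n) :
    ContinuousOn (fun y ↦ ‖coordVector (n := n) x y i‖) (extChartAt (𝓡 n) x).target := by
  simp only [norm_eq_sqrt_real_inner]
  exact Real.continuous_sqrt.comp_continuousOn
    ((continuousOn_coordVector x i).inner_bundle (continuousOn_coordVector x i))

theorem mfderiv_chart_symm_eq_sum (x : M) (y v : EuclideanSpace ℝ (Fin n)) :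
    (mfderiv (𝓡 n) (𝓡 n) (extChartAt (𝓡 n) x).symm y v :
      TangentSpace (𝓡 n) ((extChartAt (𝓡 n) x).symm y)) = ∑ i, v i • coordVector x y i := by
  have hv : v = ∑ i, v i • EuclideanSpace.single i (1 : ℝ) := by
    conv_lhs => rw [← (EuclideanSpace.basisFun (Fin n) ℝ).sum_repr v]
    simp
  conv_lhs => rw [hv]
  let A : EuclideanSpace ℝ (Fin n) →L[ℝ] TangentSpace (𝓡 n) ((extChartAt (𝓡 n) x).symm y) :=
    mfderiv (𝓡 n) (𝓡 n) (extChartAt (𝓡 n) x).symm y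
  change A _ = _
  rw [map_sum]
  exact Finset.sum_congr rfl fun i _ ↦ A.map_smul _ _

theorem norm_mfderiv_chart_symm_le (x : M) (y v : EuclideanSpace ℝ (Fin n)) :
    ‖(mfderiv (𝓡 n) (𝓡 n) (extChartAt (𝓡 n) x).symm y v :
      TangentSpace (𝓡 n) ((extChartAt (𝓡 n) x).symm y))‖ ≤
      (∑ i, ‖coordVector (n := n) x y i‖) * ‖v‖ := by
  rw [mfderiv_chart_symm_eq_sum, Finset.sum_mul]
  refine (norm_sum_le _ _).trans (Finset.sum_le_sum fun i _ ↦ ?_)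
  rw [norm_smul, mul_comm]
  exact mul_le_mul_of_nonneg_left (PiLp.norm_apply_le v i) (norm_nonneg _)

variable [IsRiemannianManifold (𝓡 n) M]

/-- The inverse of a chart is locally Lipschitz. -/
theorem exists_lipschitzOnWith_chart_symm (x : M) {y : EuclideanSpace ℝ (Fin n)}
    (hy : y ∈ (extChartAt (𝓡 n) x).target) :
    ∃ K, ∃ s ∈ 𝓝 y, LipschitzOnWith K (extChartAt (𝓡 n) x).symm s := by
  have hcont : ContinuousOn (fun z ↦ ∑ i, ‖coordVector (n := n) x z i‖)
      (extChartAt (𝓡 n) x).target :=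
    continuousOn_finsetSum _ fun i _ ↦ continuousOn_norm_coordVector x i
  have hU := (isOpen_chart_target x).mem_nhds hy
  set C : ℝ := (∑ i, ‖coordVector (n := n) x y i‖) + 1 with hC
  have hC0 : 0 ≤ C := by positivity
  have hev : ∀ᶠ z in 𝓝 y, z ∈ (extChartAt (𝓡 n) x).target ∧
      ∑ i, ‖coordVector (n := n) x z i‖ < C :=
    (eventually_mem_set.2 hU).and
      ((hcont.continuousAt hU).eventually (gt_mem_nhds (lt_add_one _)))
  obtain ⟨r, r_pos, hr⟩ := Metric.eventually_nhds_iff_ball.1 hev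
  refine ⟨C.toNNReal, Metric.ball y r, Metric.ball_mem_nhds y r_pos, fun a ha b hb ↦ ?_⟩
  rw [IsRiemannianManifold.out (I := 𝓡 n)]
  -- The distance between the images of `a` and `b` is at most the length of the image of the
  -- segment `[a, b]`. The segment stays in the convex ball, where the differential of the inverse
  -- chart has norm at most `C`.
  let η := ContinuousAffineMap.lineMap (R := ℝ) a b
  set γ := (extChartAt (𝓡 n) x).symm ∘ η with hγ
  have hη : ∀ t ∈ Icc (0 : ℝ) 1, η t ∈ Metric.ball y r := by
    intro t ht
    apply (convex_ball y r).segment_subset ha hb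
    rw [segment_eq_image_lineMap]
    exact ⟨t, ht, rfl⟩
  have η_smooth : ContMDiffOn 𝓘(ℝ, ℝ) 𝓘(ℝ, EuclideanSpace ℝ (Fin n)) 1 η (Icc 0 1) := by
    apply ContMDiff.contMDiffOn
    rw [contMDiff_iff_contDiff]
    exact ContinuousAffineMap.contDiff _
  have hlen : Manifold.riemannianEDist (𝓡 n) ((extChartAt (𝓡 n) x).symm a)
      ((extChartAt (𝓡 n) x).symm b) ≤ Manifold.pathELength (𝓡 n) γ 0 1 := by
    apply Manifold.riemannianEDist_le_pathELength _ _ _ zero_le_one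
    · exact (contMDiffOn_extChartAt_symm x).comp η_smooth fun t ht ↦ (hr _ (hη t ht)).1
    · simp [γ, η, ContinuousAffineMap.coe_lineMap_eq]
    · simp [γ, η, ContinuousAffineMap.coe_lineMap_eq]
  refine hlen.trans ?_
  rw [← lintegral_fderiv_lineMap_eq_edist,
    Manifold.pathELength_eq_lintegral_mfderivWithin_Icc,
    ← lintegral_const_mul' _ _ ENNReal.coe_ne_top]
  apply setLIntegral_mono' measurableSet_Icc (fun t ht ↦ ?_)
  have hc : mfderivWithin 𝓘(ℝ, ℝ) (𝓡 n) γ (Icc 0 1) t =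
      (mfderiv (𝓡 n) (𝓡 n) (extChartAt (𝓡 n) x).symm (η t)) ∘L
        (mfderivWithin 𝓘(ℝ, ℝ) 𝓘(ℝ, EuclideanSpace ℝ (Fin n)) η (Icc 0 1) t) := by
    apply mfderiv_comp_mfderivWithin
    · exact mdifferentiableAt_chart_symm x (hr _ (hη t ht)).1
    · exact η_smooth.mdifferentiableOn one_ne_zero t ht
    · rw [uniqueMDiffWithinAt_iff_uniqueDiffWithinAt]
      exact uniqueDiffOn_Icc zero_lt_one t ht
  have hc1 : (mfderivWithin 𝓘(ℝ, ℝ) (𝓡 n) γ (Icc 0 1) t 1 : TangentSpace (𝓡 n) (γ t)) =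
      (mfderiv (𝓡 n) (𝓡 n) (extChartAt (𝓡 n) x).symm (η t))
        (fderivWithin ℝ η (Icc 0 1) t 1) := by
    rw [hc, mfderivWithin_eq_fderivWithin]
    rfl
  rw [hc1, ← ofReal_norm, ← ofReal_norm]
  change _ ≤ ENNReal.ofReal C * _
  rw [← ENNReal.ofReal_mul hC0]
  apply ENNReal.ofReal_le_ofReal
  refine (norm_mfderiv_chart_symm_le x _ _).trans ?_
  exact mul_le_mul_of_nonneg_right (hr _ (hη t ht)).2.le (norm_nonneg _)

/-- A locally Lipschitz function read in a chart is locally Lipschitz. -/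
theorem LocallyLipschitz.lipschitzInCharts {f : M → ℝ} (hf : LocallyLipschitz f) :
    LipschitzInCharts n f := by
  intro x y hy
  obtain ⟨K, s, hs, hK⟩ := exists_lipschitzOnWith_chart_symm x hy
  obtain ⟨K', t, ht, hK'⟩ := hf ((extChartAt (𝓡 n) x).symm y)
  have hcont : ContinuousAt (extChartAt (𝓡 n) x).symm y :=
    (continuousOn_extChartAt_symm x).continuousAt ((isOpen_chart_target x).mem_nhds hy)
  refine ⟨K' * K, s ∩ (extChartAt (𝓡 n) x).symm ⁻¹' t, inter_mem hs (hcont ht), ?_⟩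
  exact hK'.comp (hK.mono inter_subset_left) fun z hz ↦ hz.2

end ChartMetric

/-! ### The Riemannian volume restricted to a chart. -/

section VolumeChange

open Set Filter Topology

variable {n : ℕ} {M : Type*} [MetricSpace M] [ChartedSpace (EuclideanSpace ℝ (Fin n)) M]
  [RiemannianBundle (fun x : M ↦ TangentSpace (𝓡 n) x)]
  [IsManifold (𝓡 n) ∞ M]
  [IsContinuousRiemannianBundle (EuclideanSpace ℝ (Fin n)) (fun x : M ↦ TangentSpace (𝓡 n) x)]

theorem differentiableAt_chart_transition (x x' : M) {y : EuclideanSpace ℝ (Fin n)}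
    (hy : y ∈ (extChartAt (𝓡 n) x).target)
    (hy' : (extChartAt (𝓡 n) x).symm y ∈ (extChartAt (𝓡 n) x').source) :
    DifferentiableAt ℝ (extChartAt (𝓡 n) x' ∘ (extChartAt (𝓡 n) x).symm) y := by
  rw [← mdifferentiableAt_iff_differentiableAt]
  rw [extChartAt_source] at hy'
  exact (mdifferentiableAt_extChartAt hy').comp y (mdifferentiableAt_chart_symm x hy)

-- With `J` the Jacobian matrix of the transition map, the Gram matrices satisfy `G = Jᵀ G' J`; the
-- densities are the square roots of the determinants.
open Matrix in
theorem volumeDensity_chart_transition (x x' : M) {y : EuclideanSpace ℝ (Fin n)}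
    (hy : y ∈ (extChartAt (𝓡 n) x).target)
    (hy' : (extChartAt (𝓡 n) x).symm y ∈ (extChartAt (𝓡 n) x').source) :
    volumeDensity (n := n) x y =
      |(fderiv ℝ (extChartAt (𝓡 n) x' ∘ (extChartAt (𝓡 n) x).symm) y).det| *
        volumeDensity (n := n) x' (extChartAt (𝓡 n) x' ((extChartAt (𝓡 n) x).symm y)) := by
  set T := extChartAt (𝓡 n) x' ∘ (extChartAt (𝓡 n) x).symm with hT
  have hTy : T y ∈ (extChartAt (𝓡 n) x').target := (extChartAt (𝓡 n) x').map_source hy'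
  let b := (EuclideanSpace.basisFun (Fin n) ℝ).toBasis
  let J : Matrix (Fin n) (Fin n) ℝ := LinearMap.toMatrix b b (fderiv ℝ T y : _ →ₗ[ℝ] _)
  have hJ : ∀ k i, J k i = fderiv ℝ T y (EuclideanSpace.single i 1) k := by
    intro k i
    simp [J, b, LinearMap.toMatrix_apply]
  have hev : (extChartAt (𝓡 n) x).symm =ᶠ[𝓝 y] (extChartAt (𝓡 n) x').symm ∘ T := by
    have hcont : ContinuousAt (extChartAt (𝓡 n) x).symm y :=
      (continuousOn_extChartAt_symm x).continuousAt ((isOpen_chart_target x).mem_nhds hy)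
    filter_upwards [hcont ((isOpen_extChartAt_source (I := 𝓡 n) x').mem_nhds hy')] with z hz
    exact ((extChartAt (𝓡 n) x').left_inv hz).symm
  have hpt := hev.eq_of_nhds
  have hD : (mfderiv (𝓡 n) (𝓡 n) (extChartAt (𝓡 n) x).symm y :
      EuclideanSpace ℝ (Fin n) →L[ℝ] EuclideanSpace ℝ (Fin n)) =
      (mfderiv (𝓡 n) (𝓡 n) (extChartAt (𝓡 n) x').symm (T y) :
        EuclideanSpace ℝ (Fin n) →L[ℝ] EuclideanSpace ℝ (Fin n)) ∘L fderiv ℝ T y := by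
    refine (Filter.EventuallyEq.mfderiv_eq hev).trans ?_
    refine (mfderiv_comp y (mdifferentiableAt_chart_symm x' hTy)
      (differentiableAt_chart_transition x x' hy hy').mdifferentiableAt).trans ?_
    rw [mfderiv_eq_fderiv]
    rfl
  -- The two descriptions of the base point are equal but not definitionally, so the metric is taken
  -- as a function of the base point with arguments in the model space; the base point can then be
  -- rewritten.
  let B : M → EuclideanSpace ℝ (Fin n) → EuclideanSpace ℝ (Fin n) → ℝ := fun p u v ↦
    @inner ℝ (TangentSpace (𝓡 n) p) _ u v
  let D : EuclideanSpace ℝ (Fin n) →L[ℝ] EuclideanSpace ℝ (Fin n) :=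
    mfderiv (𝓡 n) (𝓡 n) (extChartAt (𝓡 n) x).symm y
  let D' : EuclideanSpace ℝ (Fin n) →L[ℝ] EuclideanSpace ℝ (Fin n) :=
    mfderiv (𝓡 n) (𝓡 n) (extChartAt (𝓡 n) x').symm (T y)
  have hG : chartGram x y = Jᵀ * chartGram x' (T y) * J := by
    ext i j
    have h1 : chartGram x y i j = B ((extChartAt (𝓡 n) x).symm y)
      (D (EuclideanSpace.single i 1)) (D (EuclideanSpace.single j 1)) := by
      rfl
    have h2 : B ((extChartAt (𝓡 n) x').symm (T y))
        (D' (fderiv ℝ T y (EuclideanSpace.single i 1)))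
        (D' (fderiv ℝ T y (EuclideanSpace.single j 1))) =
        inner ℝ (∑ k, J k i • coordVector x' (T y) k) (∑ l, J l j • coordVector x' (T y) l) := by
      simp only [hJ]
      rw [← mfderiv_chart_symm_eq_sum, ← mfderiv_chart_symm_eq_sum]
      rfl
    rw [h1, hpt, show D = D' ∘L fderiv ℝ T y from hD]
    refine h2.trans ?_
    rw [inner_sum, Matrix.mul_apply]
    refine Finset.sum_congr rfl fun l _ ↦ ?_
    rw [inner_smul_right, sum_inner, mul_comm, Matrix.mul_apply]
    congr 1
    refine Finset.sum_congr rfl fun k _ ↦ ?_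
    rw [inner_smul_left]
    rfl
  have hdet : (fderiv ℝ T y).det = J.det := by
    simp [J, ContinuousLinearMap.det]
  rw [volumeDensity_eq, volumeDensity_eq, hG, Matrix.det_mul, Matrix.det_mul,
    Matrix.det_transpose, hdet, ← Real.sqrt_sq_eq_abs, ← Real.sqrt_mul (sq_nonneg _)]
  congr 1
  change J.det * (chartGram x' (T y)).det * J.det = J.det ^ 2 * (chartGram x' (T y)).det
  ring

variable [MeasurableSpace M] [BorelSpace M]

/-- A supremum of measures is not computed set by set. Instead, `ν` plus the part of the supremum
carried by `sᶜ` is an upper bound for every `m i`, hence for the supremum; restricting to `s` kills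
the added part. -/
theorem restrict_iSup_le {α ι : Type*} [MeasurableSpace α] {m : ι → Measure α} {ν : Measure α}
    {s : Set α} (hs : MeasurableSet s) (h : ∀ i, (m i).restrict s ≤ ν) :
    (⨆ i, m i).restrict s ≤ ν := by
  have h1 : ⨆ i, m i ≤ ν + (⨆ i, m i).restrict sᶜ := by
    refine iSup_le fun i ↦ ?_
    conv_lhs => rw [← Measure.restrict_add_restrict_compl (μ := m i) hs]
    exact add_le_add (h i) (Measure.restrict_mono subset_rfl (le_iSup m i))
  refine (Measure.restrict_mono subset_rfl h1).trans ?_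
  rw [Measure.restrict_add, Measure.restrict_restrict hs]
  simp [Measure.restrict_le_self]

theorem measurableSet_chart_preimage (x : M) {A : Set M} (hA : MeasurableSet A) :
    MeasurableSet ((extChartAt (𝓡 n) x).symm ⁻¹' A ∩ (extChartAt (𝓡 n) x).target) := by
  have h := (continuousOn_extChartAt_symm (I := 𝓡 n) x).domRestrict.measurable hA
  have h2 := (isOpen_chart_target (n := n) x).measurableSet.subtype_image h
  convert h2 using 1
  ext y
  simp [and_comm]

theorem aemeasurable_chart_symm (x : M) :
    AEMeasurable (extChartAt (𝓡 n) x).symm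
      ((volume.restrict (extChartAt (𝓡 n) x).target).withDensity
        fun y ↦ ENNReal.ofReal (volumeDensity (n := n) x y)) :=
  ((continuousOn_extChartAt_symm x).aemeasurable
    (isOpen_chart_target x).measurableSet).mono_ac (withDensity_absolutelyContinuous _ _)

theorem chartVolume_apply (x : M) {A : Set M} (hA : MeasurableSet A) :
    chartVolume (n := n) x A =
      ∫⁻ y in (extChartAt (𝓡 n) x).symm ⁻¹' A ∩ (extChartAt (𝓡 n) x).target,
        ENNReal.ofReal (volumeDensity (n := n) x y) := by
  rw [chartVolume, Measure.map_apply_of_aemeasurable (aemeasurable_chart_symm x) hA,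
    withDensity_apply', Measure.restrict_restrict' (isOpen_chart_target x).measurableSet]

/-- Change of variables along the transition map; its Jacobian is exactly the ratio of the two
densities. -/
theorem chartVolume_eq_of_subset (x x' : M) {A : Set M} (hA : MeasurableSet A)
    (h : A ⊆ (extChartAt (𝓡 n) x).source) (h' : A ⊆ (extChartAt (𝓡 n) x').source) :
    chartVolume (n := n) x A = chartVolume (n := n) x' A := by
  rw [chartVolume_apply x hA, chartVolume_apply x' hA]
  set T := extChartAt (𝓡 n) x' ∘ (extChartAt (𝓡 n) x).symm with hT
  set S := (extChartAt (𝓡 n) x).symm ⁻¹' A ∩ (extChartAt (𝓡 n) x).target with hS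
  have himg : (extChartAt (𝓡 n) x').symm ⁻¹' A ∩ (extChartAt (𝓡 n) x').target = T '' S := by
    ext z
    constructor
    · rintro ⟨hzA, hz⟩
      refine ⟨extChartAt (𝓡 n) x ((extChartAt (𝓡 n) x').symm z), ⟨?_, ?_⟩, ?_⟩
      · rw [mem_preimage, (extChartAt (𝓡 n) x).left_inv (h hzA)]
        exact hzA
      · exact (extChartAt (𝓡 n) x).map_source (h hzA)
      · rw [hT, Function.comp_apply, (extChartAt (𝓡 n) x).left_inv (h hzA),
          (extChartAt (𝓡 n) x').right_inv hz]
    · rintro ⟨y, ⟨hyA, hy⟩, rfl⟩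
      refine ⟨?_, (extChartAt (𝓡 n) x').map_source (h' hyA)⟩
      rw [mem_preimage, hT, Function.comp_apply, (extChartAt (𝓡 n) x').left_inv (h' hyA)]
      exact hyA
  have hinj : InjOn T S := by
    intro y hy z hz hyz
    exact (extChartAt (𝓡 n) x).symm.injOn hy.2 hz.2
      ((extChartAt (𝓡 n) x').injOn (h' hy.1) (h' hz.1) hyz)
  rw [himg, lintegral_image_eq_lintegral_abs_det_fderiv_mul volume
    (measurableSet_chart_preimage x hA)
    (fun y hy ↦ (differentiableAt_chart_transition x x' hy.2 (h' hy.1)).hasFDerivAt.hasFDerivWithinAt)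
    hinj]
  refine setLIntegral_congr_fun (measurableSet_chart_preimage x hA) fun y hy ↦ ?_
  beta_reduce
  rw [volumeDensity_chart_transition x x' hy.2 (h' hy.1), ENNReal.ofReal_mul (abs_nonneg _)]
  rfl

theorem chartVolume_compl_source (x : M) :
    chartVolume (n := n) x (extChartAt (𝓡 n) x).sourceᶜ = 0 := by
  rw [chartVolume_apply x (isOpen_extChartAt_source x).measurableSet.compl]
  have : (extChartAt (𝓡 n) x).symm ⁻¹' (extChartAt (𝓡 n) x).sourceᶜ ∩ (extChartAt (𝓡 n) x).target
      = ∅ := by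
    ext y
    simp only [mem_inter_iff, mem_preimage, mem_compl_iff, mem_empty_iff_false, iff_false, not_and]
    exact fun h1 h2 ↦ h1 ((extChartAt (𝓡 n) x).map_target h2)
  rw [this]
  simp

/-- The part of any other chart measure inside this chart lies on the overlap, where the two
measures agree, so the supremum adds nothing. -/
theorem restrict_riemannianVolume_source (x : M) :
    (riemannianVolume n M).restrict (extChartAt (𝓡 n) x).source = chartVolume (n := n) x := by
  have hsrc : MeasurableSet (extChartAt (𝓡 n) x).source :=
    (isOpen_extChartAt_source (I := 𝓡 n) x).measurableSet
  apply le_antisymm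
  · refine restrict_iSup_le hsrc fun x' ↦ Measure.le_intro fun A hA _ ↦ ?_
    rw [Measure.restrict_apply hA]
    have hsrc' : MeasurableSet (extChartAt (𝓡 n) x').source :=
      (isOpen_extChartAt_source (I := 𝓡 n) x').measurableSet
    calc chartVolume (n := n) x' (A ∩ (extChartAt (𝓡 n) x).source)
        ≤ chartVolume (n := n) x' (A ∩ (extChartAt (𝓡 n) x).source ∩ (extChartAt (𝓡 n) x').source)
          + chartVolume (n := n) x' (extChartAt (𝓡 n) x').sourceᶜ := by
          refine (measure_mono ?_).trans (measure_union_le _ _)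
          intro z hz
          by_cases h : z ∈ (extChartAt (𝓡 n) x').source
          · exact Or.inl ⟨hz, h⟩
          · exact Or.inr h
      _ = chartVolume (n := n) x (A ∩ (extChartAt (𝓡 n) x).source ∩ (extChartAt (𝓡 n) x').source) := by
          rw [chartVolume_compl_source, add_zero]
          exact chartVolume_eq_of_subset x' x ((hA.inter hsrc).inter hsrc')
            inter_subset_right (inter_subset_left.trans inter_subset_right)
      _ ≤ chartVolume (n := n) x A := measure_mono (inter_subset_left.trans inter_subset_left)
  · have h2 : (chartVolume (n := n) x).restrict (extChartAt (𝓡 n) x).source = chartVolume x :=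
      Measure.restrict_eq_self_of_ae_mem (mem_ae_iff.2 (chartVolume_compl_source x))
    rw [← h2]
    exact Measure.restrict_mono subset_rfl (le_iSup (fun x : M ↦ chartVolume (n := n) x) x)

theorem ae_mem_source_of_ae_chart (x : M) {p : M → Prop}
    (h : ∀ᵐ y : EuclideanSpace ℝ (Fin n), y ∈ (extChartAt (𝓡 n) x).target →
      p ((extChartAt (𝓡 n) x).symm y)) :
    ∀ᵐ z ∂(riemannianVolume n M), z ∈ (extChartAt (𝓡 n) x).source → p z := by
  have hsrc : MeasurableSet (extChartAt (𝓡 n) x).source :=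
    (isOpen_extChartAt_source (I := 𝓡 n) x).measurableSet
  rw [← ae_restrict_iff' hsrc, restrict_riemannianVolume_source]
  -- The predicate `p` need not be measurable, so the exceptional set is enlarged to a Borel null
  -- set before being carried to `M`.
  obtain ⟨N, hN, hNm, hN0⟩ := exists_measurable_superset_of_null (ae_iff.1 h)
  have hcont := (continuousOn_extChartAt (I := 𝓡 n) x).domRestrict.measurable hNm
  have hA : MeasurableSet ((extChartAt (𝓡 n) x) ⁻¹' N ∩ (extChartAt (𝓡 n) x).source) := by
    have h2 := hsrc.subtype_image hcont
    convert h2 using 1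
    ext y
    simp [and_comm]
  have hA0 : chartVolume (n := n) x ((extChartAt (𝓡 n) x) ⁻¹' N ∩ (extChartAt (𝓡 n) x).source) = 0 := by
    rw [chartVolume_apply x hA]
    refine setLIntegral_measure_zero _ _ (measure_mono_null ?_ hN0)
    rintro y ⟨⟨hy1, -⟩, hy2⟩
    rwa [mem_preimage, (extChartAt (𝓡 n) x).right_inv hy2] at hy1
  rw [ae_iff]
  refine measure_mono_null (t := ((extChartAt (𝓡 n) x) ⁻¹' N ∩ (extChartAt (𝓡 n) x).source) ∪
    (extChartAt (𝓡 n) x).sourceᶜ) ?_ (measure_union_null hA0 (chartVolume_compl_source x))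
  intro z hz
  by_cases hzs : z ∈ (extChartAt (𝓡 n) x).source
  · refine Or.inl ⟨hN ?_, hzs⟩
    simp only [mem_ofPred_eq, not_forall]
    refine ⟨(extChartAt (𝓡 n) x).map_source hzs, ?_⟩
    rwa [(extChartAt (𝓡 n) x).left_inv hzs]
  · exact Or.inr hzs

end VolumeChange

/-! ### Local properties of the volume, and almost everywhere differentiability. -/

section VolumeLocal

open Set Filter Topology

variable {n : ℕ} {M : Type*} [MetricSpace M] [ChartedSpace (EuclideanSpace ℝ (Fin n)) M]
  [RiemannianBundle (fun x : M ↦ TangentSpace (𝓡 n) x)]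
  [IsManifold (𝓡 n) ∞ M]
  [IsContinuousRiemannianBundle (EuclideanSpace ℝ (Fin n)) (fun x : M ↦ TangentSpace (𝓡 n) x)]
  [MeasurableSpace M] [BorelSpace M]

/-- The density is continuous, hence integrable on a closed coordinate ball. -/
instance isLocallyFiniteMeasure_riemannianVolume :
    IsLocallyFiniteMeasure (riemannianVolume n M) := by
  refine ⟨fun x ↦ ?_⟩
  have hy : extChartAt (𝓡 n) x x ∈ (extChartAt (𝓡 n) x).target := mem_extChartAt_target x
  obtain ⟨r, r_pos, hr⟩ := Metric.nhds_basis_closedBall.mem_iff.1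
    ((isOpen_chart_target x).mem_nhds hy)
  set U := (extChartAt (𝓡 n) x).source ∩
    extChartAt (𝓡 n) x ⁻¹' Metric.ball (extChartAt (𝓡 n) x x) r with hU
  have hUo : IsOpen U := isOpen_extChartAt_preimage' x Metric.isOpen_ball
  refine ⟨U, hUo.mem_nhds ⟨mem_extChartAt_source x, Metric.mem_ball_self r_pos⟩, ?_⟩
  rw [← Measure.restrict_eq_self _ (inter_subset_left : U ⊆ (extChartAt (𝓡 n) x).source),
    restrict_riemannianVolume_source, chartVolume_apply x hUo.measurableSet]
  have hint := ((continuousOn_volumeDensity (n := n) x).mono hr).integrableOn_compact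
    (μ := volume) (isCompact_closedBall _ r)
  refine (lintegral_mono_set ?_).trans_lt hint.lintegral_lt_top
  rintro z ⟨⟨-, hz⟩, hz'⟩
  rw [mem_preimage, (extChartAt (𝓡 n) x).right_inv hz'] at hz
  exact Metric.ball_subset_closedBall hz

/-- The density is strictly positive on the chart, so its integral over a nonempty open set cannot
vanish. -/
instance isOpenPosMeasure_riemannianVolume :
    Measure.IsOpenPosMeasure (riemannianVolume n M) := by
  refine ⟨fun U hU hne h0 ↦ ?_⟩
  obtain ⟨x, hx⟩ := hne
  have h1 : chartVolume (n := n) x U = 0 := by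
    rw [← restrict_riemannianVolume_source]
    exact nonpos_iff_eq_zero.1 ((Measure.restrict_le_self U).trans h0.le)
  rw [chartVolume_apply x hU.measurableSet] at h1
  set W := (extChartAt (𝓡 n) x).symm ⁻¹' U ∩ (extChartAt (𝓡 n) x).target with hW
  have hWo : IsOpen W := by
    rw [hW, inter_comm]
    exact (continuousOn_extChartAt_symm x).isOpen_inter_preimage (isOpen_chart_target x) hU
  have hWne : W.Nonempty := ⟨extChartAt (𝓡 n) x x, by
    rw [mem_preimage, extChartAt_to_inv]
    exact hx, mem_extChartAt_target x⟩
  have hmeas : AEMeasurable (fun y ↦ ENNReal.ofReal (volumeDensity (n := n) x y))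
      (volume.restrict W) :=
    (((continuousOn_volumeDensity x).mono inter_subset_right).aemeasurable
      hWo.measurableSet).ennreal_ofReal
  rw [lintegral_eq_zero_iff' hmeas, Filter.EventuallyEq, ae_restrict_iff' hWo.measurableSet] at h1
  refine (hWo.measure_pos volume hWne).ne' (measure_mono_null ?_ (ae_iff.1 h1))
  intro y hy
  simp only [mem_ofPred_eq, Classical.not_imp]
  refine ⟨hy, ?_⟩
  simpa using! volumeDensity_pos x hy.2

variable [SecondCountableTopology M]

theorem ae_of_forall_source {p : M → Prop}
    (h : ∀ x : M, ∀ᵐ z ∂(riemannianVolume n M), z ∈ (extChartAt (𝓡 n) x).source → p z) :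
    ∀ᵐ z ∂(riemannianVolume n M), p z := by
  rw [ae_iff]
  refine measure_null_of_locally_null _ fun x hx ↦ ?_
  refine ⟨{z | ¬ p z} ∩ (extChartAt (𝓡 n) x).source,
    inter_mem self_mem_nhdsWithin (mem_nhdsWithin_of_mem_nhds (extChartAt_source_mem_nhds x)), ?_⟩
  refine measure_mono_null ?_ (ae_iff.1 (h x))
  rintro z ⟨hz1, hz2⟩
  simp only [mem_ofPred_eq, Classical.not_imp]
  exact ⟨hz2, hz1⟩

theorem ae_of_ae_chart {p : M → Prop}
    (h : ∀ x : M, ∀ᵐ y : EuclideanSpace ℝ (Fin n), y ∈ (extChartAt (𝓡 n) x).target →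
      p ((extChartAt (𝓡 n) x).symm y)) :
    ∀ᵐ z ∂(riemannianVolume n M), p z :=
  ae_of_forall_source fun x ↦ ae_mem_source_of_ae_chart x (h x)

/-- The pairing of two gradients is measurable, whether or not the functions are. -/
theorem aestronglyMeasurable_inner_riemannianGrad (f h : M → ℝ) :
    AEStronglyMeasurable (fun z ↦ inner ℝ (riemannianGrad n f z) (riemannianGrad n h z))
      (riemannianVolume n M) := by
  have hloc : ∀ x : M, AEStronglyMeasurable
      (fun z ↦ inner ℝ (riemannianGrad n f z) (riemannianGrad n h z))
      ((riemannianVolume n M).restrict (extChartAt (𝓡 n) x).source) := by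
    intro x
    classical
    have hsrc : MeasurableSet (extChartAt (𝓡 n) x).source :=
      (isOpen_extChartAt_source (I := 𝓡 n) x).measurableSet
    -- Extension by zero off the chart makes the coefficients and the chart map globally Borel. The
    -- partial derivatives are Borel for an arbitrary function, since `fderiv` always is.
    let G' : EuclideanSpace ℝ (Fin n) → Matrix (Fin n) (Fin n) ℝ :=
      (extChartAt (𝓡 n) x).target.piecewise (fun y ↦ (chartGram x y)⁻¹) (fun _ ↦ 0)
    have hG' : ∀ i j, Measurable fun y ↦ G' y i j := by
      intro i j
      have h1 := ContinuousOn.measurable_piecewise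
        (f := fun y ↦ (chartGram x y)⁻¹ i j) (g := fun _ ↦ (0 : ℝ))
        (continuousOn_pi.1 (continuousOn_pi.1 (continuousOn_chartGram_inv (n := n) x) i) j)
        continuousOn_const (isOpen_chart_target x).measurableSet
      convert h1 using 2 with y
      by_cases hy : y ∈ (extChartAt (𝓡 n) x).target
      · simp only [G', Set.piecewise_eq_of_mem _ _ _ hy]
      · simp only [G', Set.piecewise_eq_of_notMem _ _ _ hy]
        rfl
    let T : M → EuclideanSpace ℝ (Fin n) :=
      (extChartAt (𝓡 n) x).source.piecewise (extChartAt (𝓡 n) x) (fun _ ↦ 0)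
    have hT : Measurable T :=
      (continuousOn_extChartAt x).measurable_piecewise continuousOn_const hsrc
    let Q : EuclideanSpace ℝ (Fin n) → ℝ := fun y ↦
      ∑ i, chartDeriv x f y i * ∑ j, G' y i j * chartDeriv x h y j
    have hQ : Measurable Q := by
      refine Finset.measurable_sum _ fun i _ ↦ ?_
      refine (measurable_fderiv_apply_const ℝ _ _).mul ?_
      exact Finset.measurable_sum _ fun j _ ↦
        (hG' i j).mul (measurable_fderiv_apply_const ℝ _ _)
    refine ((hQ.comp hT).aestronglyMeasurable).congr ?_
    rw [Filter.EventuallyEq, ae_restrict_iff' hsrc]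
    refine Eventually.of_forall fun z hz ↦ ?_
    have hz' := (extChartAt (𝓡 n) x).map_source hz
    have := inner_riemannianGrad_chart x hz' f h
    rw [(extChartAt (𝓡 n) x).left_inv hz] at this
    rw [this]
    simp only [Function.comp_apply, T, Set.piecewise_eq_of_mem _ _ _ hz, Q, G',
      Set.piecewise_eq_of_mem _ _ _ hz']
    rfl
  obtain ⟨s, hs, hU⟩ := TopologicalSpace.countable_cover_nhds
    fun x : M ↦ extChartAt_source_mem_nhds (I := 𝓡 n) x
  rw [← Measure.restrict_univ (μ := riemannianVolume n M), ← hU]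
  have : Countable s := hs.to_subtype
  rw [biUnion_eq_iUnion, aestronglyMeasurable_iUnion_iff]
  exact fun i ↦ hloc i

/-- A bound of the gradient in terms of the differential in a chart. -/
theorem sq_norm_riemannianGrad_le (x : M) {y : EuclideanSpace ℝ (Fin n)}
    (hy : y ∈ (extChartAt (𝓡 n) x).target) (f : M → ℝ) :
    ‖riemannianGrad n f ((extChartAt (𝓡 n) x).symm y)‖ ^ 2 ≤
      (∑ i, ∑ j, |(chartGram (n := n) x y)⁻¹ i j|) *
        ‖fderiv ℝ (f ∘ (extChartAt (𝓡 n) x).symm) y‖ ^ 2 := by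
  rw [← real_inner_self_eq_norm_sq, inner_riemannianGrad_chart x hy, Finset.sum_mul]
  have hd : ∀ i, |chartDeriv x f y i| ≤ ‖fderiv ℝ (f ∘ (extChartAt (𝓡 n) x).symm) y‖ := by
    intro i
    have := (fderiv ℝ (f ∘ (extChartAt (𝓡 n) x).symm) y).le_opNorm (EuclideanSpace.single i 1)
    simpa using! this
  set D := ‖fderiv ℝ (f ∘ (extChartAt (𝓡 n) x).symm) y‖
  simp only [dotProduct, Matrix.mulVec, Finset.mul_sum, Finset.sum_mul]
  refine Finset.sum_le_sum fun i _ ↦ Finset.sum_le_sum fun j _ ↦ ?_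
  refine (le_abs_self _).trans ?_
  rw [abs_mul, abs_mul]
  calc |chartDeriv x f y i| * (|(chartGram x y)⁻¹ i j| * |chartDeriv x f y j|)
      ≤ D * (|(chartGram x y)⁻¹ i j| * D) := by
        gcongr
        · exact hd i
        · exact hd j
    _ = _ := by ring

theorem LipschitzInCharts.continuous {f : M → ℝ} (hf : LipschitzInCharts n f) :
    Continuous f := by
  refine continuous_iff_continuousAt.2 fun x ↦ ?_
  have hy : extChartAt (𝓡 n) x x ∈ (extChartAt (𝓡 n) x).target := mem_extChartAt_target x
  obtain ⟨K, s, hs, hK⟩ := hf x _ hy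
  have h1 := (hK.continuousOn.continuousAt hs).comp (continuousAt_extChartAt (I := 𝓡 n) x)
  refine h1.congr ?_
  filter_upwards [extChartAt_source_mem_nhds (I := 𝓡 n) x] with z hz
  exact congrArg f ((extChartAt (𝓡 n) x).left_inv hz)

/-- A function of two variables, of class `C¹`, applied to two functions that are locally Lipschitz
in charts. -/
theorem LipschitzInCharts.comp₂ {f g h : M → ℝ} (hf : LipschitzInCharts n f)
    (hg : LipschitzInCharts n g)
    (hh : ∀ z, ∃ F : ℝ × ℝ → ℝ, ContDiffAt ℝ 1 F (f z, g z) ∧ h =ᶠ[𝓝 z] fun a ↦ F (f a, g a)) :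
    LipschitzInCharts n h := by
  intro x y hy
  obtain ⟨K₁, s₁, hs₁, hK₁⟩ := hf x y hy
  obtain ⟨K₂, s₂, hs₂, hK₂⟩ := hg x y hy
  obtain ⟨F, hF, hhF⟩ := hh ((extChartAt (𝓡 n) x).symm y)
  obtain ⟨K, t, ht, hK⟩ := hF.exists_lipschitzOnWith
  have hcont : ContinuousAt (extChartAt (𝓡 n) x).symm y :=
    (continuousOn_extChartAt_symm x).continuousAt ((isOpen_chart_target x).mem_nhds hy)
  have hcont' : ContinuousAt (fun a ↦ (f ((extChartAt (𝓡 n) x).symm a),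
      g ((extChartAt (𝓡 n) x).symm a))) y :=
    (hK₁.continuousOn.continuousAt hs₁).prodMk (hK₂.continuousOn.continuousAt hs₂)
  set W : Set (EuclideanSpace ℝ (Fin n)) := {a | a ∈ s₁ ∧ a ∈ s₂ ∧
    h ((extChartAt (𝓡 n) x).symm a) = F (f ((extChartAt (𝓡 n) x).symm a),
      g ((extChartAt (𝓡 n) x).symm a)) ∧
    (f ((extChartAt (𝓡 n) x).symm a), g ((extChartAt (𝓡 n) x).symm a)) ∈ t} with hW
  have hWn : W ∈ 𝓝 y := by
    filter_upwards [hs₁, hs₂, hcont.eventually hhF, hcont'.preimage_mem_nhds ht] with a h1 h2 h3 h4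
    exact ⟨h1, h2, h3, h4⟩
  refine ⟨K * max K₁ K₂, W, hWn, ?_⟩
  have h1 := hK.comp ((hK₁.mono (fun a (ha : a ∈ W) ↦ ha.1)).prodMk
    (hK₂.mono (fun a (ha : a ∈ W) ↦ ha.2.1))) fun a (ha : a ∈ W) ↦ ha.2.2.2
  intro a ha b hb
  simp only [Function.comp_apply]
  rw [ha.2.2.1, hb.2.2.1]
  exact h1 ha hb

/-- Rademacher's theorem in each chart. On the interior of a set, differentiability within it is
differentiability. -/
theorem LipschitzInCharts.ae_mdifferentiableAt {f : M → ℝ} (hf : LipschitzInCharts n f) :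
    ∀ᵐ z ∂(riemannianVolume n M), MDifferentiableAt (𝓡 n) 𝓘(ℝ, ℝ) f z := by
  refine ae_of_ae_chart fun x ↦ ?_
  rw [ae_iff]
  refine measure_null_of_locally_null _ fun y hy ↦ ?_
  simp only [mem_ofPred_eq, Classical.not_imp] at hy
  obtain ⟨K, s, hs, hK⟩ := hf x y hy.1
  refine ⟨_ ∩ interior s, inter_mem self_mem_nhdsWithin
    (mem_nhdsWithin_of_mem_nhds (interior_mem_nhds.2 hs)), ?_⟩
  refine measure_mono_null ?_ (ae_iff.1
    ((hK.mono interior_subset).ae_differentiableWithinAt_of_mem (μ := volume)))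
  rintro z ⟨hz1, hz2⟩
  simp only [mem_ofPred_eq, Classical.not_imp] at hz1 ⊢
  refine ⟨hz2, fun h ↦ hz1.2 ?_⟩
  rw [mdifferentiableAt_iff_chart x hz1.1]
  exact h.differentiableAt (isOpen_interior.mem_nhds hz2)

/-- Near each point the chart derivative is bounded by the Lipschitz constant and `G⁻¹` by
continuity; compactness does the rest. The bound holds at every point, thanks to the default value
of the derivative. -/
theorem LipschitzInCharts.exists_norm_riemannianGrad_le {f : M → ℝ} (hf : LipschitzInCharts n f)
    {K : Set M} (hK : IsCompact K) : ∃ C, ∀ z ∈ K, ‖riemannianGrad n f z‖ ≤ C := by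
  refine IsCompact.induction_on (p := fun s ↦ ∃ C, ∀ z ∈ s, ‖riemannianGrad n f z‖ ≤ C) hK
    ⟨0, by simp⟩ (fun s t hst ⟨C, hC⟩ ↦ ⟨C, fun z hz ↦ hC z (hst hz)⟩)
    (fun s t ⟨C, hC⟩ ⟨C', hC'⟩ ↦ ⟨max C C', fun z hz ↦
      hz.elim (fun h ↦ (hC z h).trans (le_max_left _ _))
        fun h ↦ (hC' z h).trans (le_max_right _ _)⟩) fun x hx ↦ ?_
  have hy : extChartAt (𝓡 n) x x ∈ (extChartAt (𝓡 n) x).target := mem_extChartAt_target x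
  obtain ⟨L, s, hs, hL⟩ := hf x _ hy
  have hcont : ContinuousOn (fun y ↦ ∑ i, ∑ j, |(chartGram (n := n) x y)⁻¹ i j|)
      (extChartAt (𝓡 n) x).target :=
    continuousOn_finsetSum _ fun i _ ↦ continuousOn_finsetSum _ fun j _ ↦
      (continuousOn_pi.1 (continuousOn_pi.1 (continuousOn_chartGram_inv (n := n) x) i) j).abs
  have hU := (isOpen_chart_target x).mem_nhds hy
  set N := (∑ i, ∑ j, |(chartGram (n := n) x (extChartAt (𝓡 n) x x))⁻¹ i j|) + 1
  have hev : ∀ᶠ y in 𝓝 (extChartAt (𝓡 n) x x), ∑ i, ∑ j, |(chartGram (n := n) x y)⁻¹ i j| < N :=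
    (hcont.continuousAt hU).eventually (gt_mem_nhds (lt_add_one _))
  have hall := (continuousAt_extChartAt (I := 𝓡 n) x).eventually
    (hev.and (eventually_eventually_nhds.2 hs))
  refine ⟨_, mem_nhdsWithin_of_mem_nhds (hall.and (extChartAt_source_mem_nhds (I := 𝓡 n) x)),
    Real.sqrt (N * L ^ 2), ?_⟩
  rintro z ⟨⟨hz1, hz2⟩, hz3⟩
  apply Real.le_sqrt_of_sq_le
  have h1 := sq_norm_riemannianGrad_le x ((extChartAt (𝓡 n) x).map_source hz3) f
  rw [(extChartAt (𝓡 n) x).left_inv hz3] at h1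
  refine h1.trans ?_
  have h2 : ‖fderiv ℝ (f ∘ (extChartAt (𝓡 n) x).symm) (extChartAt (𝓡 n) x z)‖ ≤ L :=
    norm_fderiv_le_of_lipschitzOn ℝ hz2 hL
  gcongr

end VolumeLocal

/-! ### Mollification of Lipschitz functions on Euclidean space. -/

section Mollification

open Set Filter Topology Metric
open scoped Convolution Pointwise NNReal

variable {E : Type*} [NormedAddCommGroup E] [InnerProductSpace ℝ E] [FiniteDimensional ℝ E]
  [MeasurableSpace E] [BorelSpace E]

/-- A locally Lipschitz function with compact support is Lipschitz. -/
theorem LocallyLipschitz.exists_lipschitzWith_of_hasCompactSupport {h : E → ℝ}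
    (hh : LocallyLipschitz h) (hc : HasCompactSupport h) : ∃ L, LipschitzWith L h := by
  have hK : IsCompact (cthickening 1 (tsupport h)) := IsCompact.cthickening hc
  obtain ⟨C, hC⟩ := hh.locallyLipschitzOn.exists_lipschitzOnWith_of_compact hK
  obtain ⟨B, hB⟩ := hh.continuous.bounded_above_of_compact_support hc
  -- If one point lies in the support and the other outside its unit thickening, they are at
  -- distance at least `1`, so the sup bound `B` serves as a Lipschitz constant.
  have hfar : ∀ x y, x ∈ tsupport h → y ∉ cthickening 1 (tsupport h) →
      dist (h x) (h y) ≤ max C B.toNNReal * dist x y := by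
    intro x y hx hy
    have hy0 : h y = 0 := image_eq_zero_of_notMem_tsupport fun h' ↦
      hy (self_subset_cthickening _ h')
    have hd : 1 ≤ dist x y := by
      by_contra hlt
      exact hy (mem_cthickening_of_dist_le y x 1 _ hx (by rw [dist_comm]; exact (not_le.1 hlt).le))
    rw [hy0, dist_zero_right]
    calc ‖h x‖ ≤ B := hB x
      _ ≤ (B.toNNReal : ℝ) := Real.le_coe_toNNReal B
      _ ≤ max (C : ℝ) B.toNNReal := le_max_right _ _
      _ ≤ _ := le_mul_of_one_le_right (by positivity) hd
  refine ⟨max C B.toNNReal, LipschitzWith.of_dist_le_mul fun x y ↦ ?_⟩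
  push_cast
  by_cases hx : x ∈ cthickening 1 (tsupport h) <;> by_cases hy : y ∈ cthickening 1 (tsupport h)
  · refine (hC.dist_le_mul x hx y hy).trans ?_
    gcongr
    exact le_max_left _ _
  · by_cases hx' : x ∈ tsupport h
    · exact hfar x y hx' hy
    · rw [image_eq_zero_of_notMem_tsupport hx', image_eq_zero_of_notMem_tsupport fun h' ↦
        hy (self_subset_cthickening _ h'), dist_self]
      positivity
  · by_cases hy' : y ∈ tsupport h
    · rw [dist_comm (h x), dist_comm x]
      exact hfar y x hy' hx
    · rw [image_eq_zero_of_notMem_tsupport hy', image_eq_zero_of_notMem_tsupport fun h' ↦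
        hx (self_subset_cthickening _ h'), dist_self]
      positivity
  · rw [image_eq_zero_of_notMem_tsupport fun h' ↦ hy (self_subset_cthickening _ h'),
      image_eq_zero_of_notMem_tsupport fun h' ↦ hx (self_subset_cthickening _ h'), dist_self]
    positivity

/-- The derivative is put on `h` rather than on the bump: `h` is differentiable at `x - t` for
almost every `t`, and the integrand is Lipschitz in `x` with the integrable constant `φ(t) L`. The
derivative of the mollification is thus an average of `fderiv ℝ h`, and inherits its bound. -/
theorem hasFDerivAt_normed_convolution (φ : ContDiffBump (0 : E)) {h : E → ℝ} {L : ℝ≥0}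
    (hL : LipschitzWith L h) (x : E) :
    HasFDerivAt (φ.normed volume ⋆[ContinuousLinearMap.lsmul ℝ ℝ, volume] h : E → ℝ)
      ((φ.normed volume ⋆[ContinuousLinearMap.lsmul ℝ ℝ, volume] (fderiv ℝ h) : E → E →L[ℝ] ℝ) x)
      x := by
  have hnc : Continuous (φ.normed (volume : Measure E)) := φ.continuous_normed
  have hcs : HasCompactSupport (φ.normed (volume : Measure E)) := φ.hasCompactSupport_normed
  have hi : Integrable (fun t ↦ φ.normed (volume : Measure E) t * L) :=
    φ.integrable_normed.mul_const _
  have hfd : Measurable fun t ↦ fderiv ℝ h (x - t) :=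
    (measurable_fderiv ℝ h).comp (measurable_const.sub measurable_id)
  refine (hasFDerivAt_integral_of_dominated_loc_of_lip (μ := (volume : Measure E))
    (F := fun y t ↦ φ.normed volume t • h (y - t))
    (F' := fun t ↦ φ.normed volume t • fderiv ℝ h (x - t))
    (bound := fun t ↦ φ.normed volume t * L) (s := univ) univ_mem ?_ ?_ ?_ ?_ hi ?_).2
  · refine Eventually.of_forall fun y ↦ Continuous.aestronglyMeasurable ?_
    exact hnc.smul (hL.continuous.comp (continuous_const.sub continuous_id))
  · refine Continuous.integrable_of_hasCompactSupport ?_ ?_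
    · exact hnc.smul (hL.continuous.comp (continuous_const.sub continuous_id))
    · exact hcs.smul_right
  · exact hnc.aestronglyMeasurable.smul hfd.aestronglyMeasurable
  · refine Eventually.of_forall fun t ↦ ?_
    rw [lipschitzOnWith_univ]
    refine LipschitzWith.of_dist_le_mul fun y z ↦ ?_
    have h0 : 0 ≤ φ.normed (volume : Measure E) t := φ.nonneg_normed t
    have h1 := hL.dist_le_mul (y - t) (z - t)
    rw [dist_sub_right] at h1
    rw [Real.dist_eq] at h1 ⊢
    simp only [smul_eq_mul, Real.coe_nnabs]
    rw [← mul_sub, abs_mul, abs_mul, abs_of_nonneg h0, NNReal.abs_eq, mul_assoc]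
    gcongr
  · have hq := (quasiMeasurePreserving_sub_left (volume : Measure E) x).ae hL.ae_differentiableAt
    filter_upwards [hq] with t ht
    have h2 : HasFDerivAt (fun y ↦ h (y - t)) (fderiv ℝ h (x - t)) x := by
      simpa using! ht.hasFDerivAt.comp x ((hasFDerivAt_id x).sub_const t)
    exact h2.const_smul (φ.normed volume t)

theorem norm_normed_convolution_le (φ : ContDiffBump (0 : E)) {F : Type*} [NormedAddCommGroup F]
    [NormedSpace ℝ F] {u : E → F} {C : ℝ} (hu : ∀ x, ‖u x‖ ≤ C) (x : E) :
    ‖(φ.normed volume ⋆[ContinuousLinearMap.lsmul ℝ ℝ, volume] u : E → F) x‖ ≤ C := by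
  rw [convolution_def]
  refine (norm_integral_le_of_norm_le (φ.integrable_normed.mul_const C)
    (Eventually.of_forall fun t ↦ ?_)).trans_eq ?_
  · simp only [ContinuousLinearMap.lsmul_apply, norm_smul]
    rw [Real.norm_of_nonneg (φ.nonneg_normed t)]
    exact mul_le_mul_of_nonneg_left (hu _) (φ.nonneg_normed t)
  · rw [integral_mul_const, φ.integral_normed, one_mul]

/-- Mollification of a nonnegative Lipschitz function with compact support: the approximations
converge pointwise, and their derivatives are bounded and converge almost everywhere. -/
theorem exists_contDiff_approximation {h : E → ℝ} {L : ℝ≥0} (hL : LipschitzWith L h)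
    (hc : HasCompactSupport h) (h0 : ∀ x, 0 ≤ h x) {δ : ℝ} (hδ : 0 < δ) :
    ∃ g : ℕ → E → ℝ, (∀ k, ContDiff ℝ ∞ (g k)) ∧ (∀ k x, 0 ≤ g k x) ∧
      (∀ k, Function.support (g k) ⊆ cthickening δ (tsupport h)) ∧
      (∃ B, ∀ k x, |g k x| ≤ B) ∧ (∀ k x, ‖fderiv ℝ (g k) x‖ ≤ L) ∧
      (∀ x, Tendsto (fun k ↦ g k x) atTop (𝓝 (h x))) ∧
      ∀ᵐ x, Tendsto (fun k ↦ fderiv ℝ (g k) x) atTop (𝓝 (fderiv ℝ h x)) := by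
  have hpos : ∀ k : ℕ, 0 < δ / (k + 1) := fun k ↦ by positivity
  -- Outer radii tend to `0` and stay at most `δ`, which controls the supports; the fixed ratio `2`
  -- of outer to inner radius is what Lebesgue differentiation requires.
  let φ : ℕ → ContDiffBump (0 : E) := fun k ↦
    ⟨δ / (k + 1) / 2, δ / (k + 1), half_pos (hpos k), half_lt_self (hpos k)⟩
  have hrOut : Tendsto (fun k ↦ (φ k).rOut) atTop (𝓝 0) :=
    tendsto_const_div_atTop_nhds_zero_nat δ |>.comp (tendsto_add_atTop_nat 1) |>.congr
      fun k ↦ by simp [φ]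
  have hle : ∀ k, (φ k).rOut ≤ δ := fun k ↦ div_le_self hδ.le (by simp)
  obtain ⟨B, hB⟩ := hL.continuous.bounded_above_of_compact_support hc
  have hfd := fun k ↦ hasFDerivAt_normed_convolution (φ k) hL
  refine ⟨fun k ↦ ((φ k).normed volume ⋆[ContinuousLinearMap.lsmul ℝ ℝ, volume] h : E → ℝ),
    fun k ↦ ?_, fun k x ↦ ?_, fun k ↦ ?_, ⟨B, fun k ↦ norm_normed_convolution_le (φ k) hB⟩, fun k x ↦ ?_, fun x ↦ ?_, ?_⟩
  · exact (φ k).hasCompactSupport_normed.contDiff_convolution_left _ (φ k).contDiff_normed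
      hL.continuous.locallyIntegrable
  · exact integral_nonneg fun t ↦ mul_nonneg ((φ k).nonneg_normed t) (h0 _)
  · refine (support_convolution_subset _).trans ?_
    rw [(φ k).support_normed_eq]
    rintro _ ⟨a, ha, b, hb, rfl⟩
    refine mem_cthickening_of_dist_le _ b _ _ (subset_tsupport h hb) ?_
    rw [dist_eq_norm, add_sub_cancel_right]
    rw [mem_ball_zero_iff] at ha
    exact ha.le.trans (hle k)
  · rw [(hfd k x).fderiv]
    exact norm_normed_convolution_le (φ k) (fun y ↦ norm_fderiv_le_of_lipschitz ℝ hL) x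
  · exact ContDiffBump.convolution_tendsto_right_of_continuous hrOut hL.continuous x
  · have hli : LocallyIntegrable (fderiv ℝ h) := by
      refine MemLp.locallyIntegrable (p := ⊤) (memLp_top_of_bound
        (measurable_fderiv ℝ h).aestronglyMeasurable L
        (Eventually.of_forall fun y ↦ norm_fderiv_le_of_lipschitz ℝ hL)) le_top
    filter_upwards [ContDiffBump.ae_convolution_tendsto_right_of_locallyIntegrable (K := 2) hrOut
      (Eventually.of_forall fun k ↦ by simp [φ]; linarith [hpos k]) hli] with x hx
    refine hx.congr fun k ↦ ?_
    rw [(hfd k x).fderiv]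

end Mollification

/-! ### Calculus rules for the gradient. -/

section GradientCalculus

open Set Filter Topology

variable {n : ℕ} {M : Type*} [MetricSpace M] [ChartedSpace (EuclideanSpace ℝ (Fin n)) M]
  [RiemannianBundle (fun x : M ↦ TangentSpace (𝓡 n) x)]
  [IsManifold (𝓡 n) ∞ M]

theorem mfderiv_apply_mfderiv_chart_symm (x : M) {y : EuclideanSpace ℝ (Fin n)}
    (hy : y ∈ (extChartAt (𝓡 n) x).target) (f : M → ℝ) (v : EuclideanSpace ℝ (Fin n)) :
    (mfderiv (𝓡 n) 𝓘(ℝ, ℝ) f ((extChartAt (𝓡 n) x).symm y)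
      (mfderiv (𝓡 n) (𝓡 n) (extChartAt (𝓡 n) x).symm y v) : ℝ) =
      fderiv ℝ (f ∘ (extChartAt (𝓡 n) x).symm) y v := by
  by_cases h : MDifferentiableAt (𝓡 n) 𝓘(ℝ, ℝ) f ((extChartAt (𝓡 n) x).symm y)
  · have := mfderiv_comp y h (mdifferentiableAt_chart_symm x hy)
    rw [mfderiv_eq_fderiv] at this
    rw [this]
    rfl
  · have h' := mt (mdifferentiableAt_iff_chart x hy f).2 h
    rw [mfderiv_zero_of_not_mdifferentiableAt h, fderiv_zero_of_not_differentiableAt h']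
    rfl

/-- A linear relation between the differentials in a chart gives one between the gradients. -/
theorem riemannianGrad_eq_smul_add_smul (x : M) {y : EuclideanSpace ℝ (Fin n)}
    (hy : y ∈ (extChartAt (𝓡 n) x).target) {f f₁ f₂ : M → ℝ} {a b : ℝ}
    (h : fderiv ℝ (f ∘ (extChartAt (𝓡 n) x).symm) y =
      a • fderiv ℝ (f₁ ∘ (extChartAt (𝓡 n) x).symm) y +
        b • fderiv ℝ (f₂ ∘ (extChartAt (𝓡 n) x).symm) y) :
    riemannianGrad n f ((extChartAt (𝓡 n) x).symm y) =
      a • riemannianGrad n f₁ ((extChartAt (𝓡 n) x).symm y) +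
        b • riemannianGrad n f₂ ((extChartAt (𝓡 n) x).symm y) := by
  refine ext_inner_right ℝ fun v ↦ ?_
  obtain ⟨e, he⟩ := isInvertible_mfderiv_chart_symm x hy
  -- Every tangent vector comes from the chart, so testing against such vectors determines the
  -- gradient.
  obtain ⟨u, rfl⟩ := e.surjective v
  have hu : e u = mfderiv (𝓡 n) (𝓡 n) (extChartAt (𝓡 n) x).symm y u := by
    rw [← he]
    rfl
  have key := fun f ↦ mfderiv_apply_mfderiv_chart_symm x hy f u
  rw [inner_add_left, inner_smul_left, inner_smul_left, inner_riemannianGrad_left,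
    inner_riemannianGrad_left, inner_riemannianGrad_left, hu]
  refine (key f).trans ?_
  rw [h]
  exact (congrArg₂ (a * · + b * ·) (key f₁) (key f₂)).symm

/-- A linear relation between the differentials in the chart around `z` gives one between the
gradients at `z`. -/
theorem riemannianGrad_eq_of_forall_fderiv (z : M) {f f₁ f₂ : M → ℝ} {a b : ℝ}
    (h : DifferentiableAt ℝ (f₁ ∘ (extChartAt (𝓡 n) z).symm) (extChartAt (𝓡 n) z z) →
      DifferentiableAt ℝ (f₂ ∘ (extChartAt (𝓡 n) z).symm) (extChartAt (𝓡 n) z z) →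
      fderiv ℝ (f ∘ (extChartAt (𝓡 n) z).symm) (extChartAt (𝓡 n) z z) =
      a • fderiv ℝ (f₁ ∘ (extChartAt (𝓡 n) z).symm) (extChartAt (𝓡 n) z z) +
        b • fderiv ℝ (f₂ ∘ (extChartAt (𝓡 n) z).symm) (extChartAt (𝓡 n) z z))
    (h₁ : MDifferentiableAt (𝓡 n) 𝓘(ℝ, ℝ) f₁ z) (h₂ : MDifferentiableAt (𝓡 n) 𝓘(ℝ, ℝ) f₂ z) :
    riemannianGrad n f z = a • riemannianGrad n f₁ z + b • riemannianGrad n f₂ z := by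
  have hy := mem_extChartAt_target (I := 𝓡 n) z
  have hz := extChartAt_to_inv (I := 𝓡 n) z
  have h1 := mdifferentiableAt_iff_chart z hy f₁
  have h2 := mdifferentiableAt_iff_chart z hy f₂
  rw [hz] at h1 h2
  have := riemannianGrad_eq_smul_add_smul z hy (h (h1.1 h₁) (h2.1 h₂))
  rwa [hz] at this

theorem riemannianGrad_add {f₁ f₂ : M → ℝ} {z : M}
    (h₁ : MDifferentiableAt (𝓡 n) 𝓘(ℝ, ℝ) f₁ z) (h₂ : MDifferentiableAt (𝓡 n) 𝓘(ℝ, ℝ) f₂ z) :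
    riemannianGrad n (fun x ↦ f₁ x + f₂ x) z = riemannianGrad n f₁ z + riemannianGrad n f₂ z := by
  have := riemannianGrad_eq_of_forall_fderiv (f := fun x ↦ f₁ x + f₂ x) (a := 1) (b := 1) z
    (fun d1 d2 ↦ by rw [one_smul, one_smul]; exact fderiv_add d1 d2) h₁ h₂
  rwa [one_smul, one_smul] at this

theorem riemannianGrad_sq {f : M → ℝ} {z : M} (hf : MDifferentiableAt (𝓡 n) 𝓘(ℝ, ℝ) f z) :
    riemannianGrad n (fun x ↦ f x ^ 2) z = (2 * f z) • riemannianGrad n f z := by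
  have := riemannianGrad_eq_of_forall_fderiv (f := fun x ↦ f x ^ 2) (a := 2 * f z) (b := 0) z
    (fun d1 _ ↦ by
      have hd := (d1.hasFDerivAt.pow 2).fderiv
      simp only [Function.comp_apply, extChartAt_to_inv, Nat.add_one_sub_one, pow_one,
        nsmul_eq_mul, Nat.cast_ofNat] at hd
      rw [zero_smul, add_zero, ← hd]
      rfl) hf hf
  rwa [zero_smul, add_zero] at this

theorem riemannianGrad_sq_mul_comp {φ w : M → ℝ} {g : ℝ → ℝ} {g' : ℝ} {z : M}
    (hφ : MDifferentiableAt (𝓡 n) 𝓘(ℝ, ℝ) φ z) (hw : MDifferentiableAt (𝓡 n) 𝓘(ℝ, ℝ) w z)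
    (hg : HasDerivAt g g' (w z)) :
    riemannianGrad n (fun x ↦ φ x ^ 2 * g (w x)) z =
      (2 * φ z * g (w z)) • riemannianGrad n φ z + (φ z ^ 2 * g') • riemannianGrad n w z := by
  refine riemannianGrad_eq_of_forall_fderiv z (fun d1 d2 ↦ ?_) hφ hw
  have hz := extChartAt_to_inv (I := 𝓡 n) z
  have hg2 : HasDerivAt g g' ((w ∘ (extChartAt (𝓡 n) z).symm) (extChartAt (𝓡 n) z z)) := by
    rwa [Function.comp_apply, hz]
  have hd := ((d1.hasFDerivAt.pow 2).mul (hg2.comp_hasFDerivAt _ d2.hasFDerivAt)).fderiv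
  simp only [Function.comp_apply, hz, Nat.add_one_sub_one, pow_one,
    nsmul_eq_mul, Nat.cast_ofNat] at hd
  refine Eq.trans hd ?_
  rw [smul_smul, smul_smul, add_comm]
  congr 2
  ring

theorem riemannianGrad_congr {f g : M → ℝ} {z : M} (h : f =ᶠ[𝓝 z] g) :
    riemannianGrad n f z = riemannianGrad n g z := by
  unfold riemannianGrad
  rw [h.mfderiv_eq]

theorem riemannianGrad_eq_zero_of_eventuallyEq {f : M → ℝ} {z : M} (h : f =ᶠ[𝓝 z] 0) :
    riemannianGrad n f z = 0 := by
  have hy := mem_extChartAt_target (I := 𝓡 n) z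
  have hz := extChartAt_to_inv (I := 𝓡 n) z
  rw [riemannianGrad_congr h]
  have h1 : fderiv ℝ ((0 : M → ℝ) ∘ (extChartAt (𝓡 n) z).symm) (extChartAt (𝓡 n) z z) = 0 :=
    fderiv_const_apply 0
  have := riemannianGrad_eq_smul_add_smul (f := (0 : M → ℝ)) (f₁ := 0) (f₂ := 0) (a := 0) (b := 0)
    z hy (by rw [h1]; simp)
  rw [hz] at this
  simpa using! this

/-- Fermat's rule in the chart. No differentiability is required, since the default value is also
zero. -/
theorem IsLocalExtr.riemannianGrad_eq_zero {f : M → ℝ} {z : M} (h : IsLocalExtr f z) :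
    riemannianGrad n f z = 0 := by
  have hy := mem_extChartAt_target (I := 𝓡 n) z
  have hz := extChartAt_to_inv (I := 𝓡 n) z
  have hcont : ContinuousAt (extChartAt (𝓡 n) z).symm (extChartAt (𝓡 n) z z) :=
    continuousAt_extChartAt_symm z
  have hloc : IsLocalExtr (f ∘ (extChartAt (𝓡 n) z).symm) (extChartAt (𝓡 n) z z) := by
    have hcont' : Tendsto (extChartAt (𝓡 n) z).symm (𝓝 (extChartAt (𝓡 n) z z)) (𝓝 z) := by
      simpa [ContinuousAt] using! hcont
    rcases h with h | h
    · left
      filter_upwards [hcont'.eventually h] with y hy'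
      simpa only [Function.comp_apply, hz] using hy'
    · right
      filter_upwards [hcont'.eventually h] with y hy'
      simpa only [Function.comp_apply, hz] using hy'
  have := riemannianGrad_eq_smul_add_smul (f := f) (f₁ := f) (f₂ := f) (a := 0) (b := 0)
    z hy (by rw [hloc.fderiv_eq_zero]; simp)
  rw [hz] at this
  simpa using! this

/-- Where `f ≠ 0`, `|f|` is locally `f` or `-f`; where `f = 0`, `|f|` has a minimum and its gradient
is zero. -/
theorem norm_riemannianGrad_abs_le {f : M → ℝ} {z : M} (hf : ContinuousAt f z) :
    ‖riemannianGrad n (fun x ↦ |f x|) z‖ ≤ ‖riemannianGrad n f z‖ := by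
  rcases lt_trichotomy (f z) 0 with h | h | h
  · have h1 : (fun x ↦ |f x|) =ᶠ[𝓝 z] fun x ↦ -f x := by
      filter_upwards [hf.eventually (gt_mem_nhds h)] with x hx using abs_of_neg hx
    have hy := mem_extChartAt_target (I := 𝓡 n) z
    have hz := extChartAt_to_inv (I := 𝓡 n) z
    have := riemannianGrad_eq_smul_add_smul (f := fun x ↦ -f x) (f₁ := f) (f₂ := f) (a := -1)
      (b := 0) z hy (by
        rw [zero_smul, add_zero, neg_one_smul]
        exact fderiv_fun_neg)
    rw [hz] at this
    rw [riemannianGrad_congr h1, this]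
    simp
  · have : IsLocalExtr (fun x ↦ |f x|) z := Or.inl (Eventually.of_forall fun x ↦ by
      simp only [h, abs_zero]
      exact abs_nonneg _)
    rw [this.riemannianGrad_eq_zero, norm_zero]
    exact norm_nonneg _
  · have h1 : (fun x ↦ |f x|) =ᶠ[𝓝 z] f := by
      filter_upwards [hf.eventually (lt_mem_nhds h)] with x hx using abs_of_pos hx
    rw [riemannianGrad_congr h1]

end GradientCalculus

/-! ### Extending the weak inequality to Lipschitz test functions. -/

section LipschitzTest

open Set Filter Topology Metric

variable {n : ℕ} {M : Type*} [MetricSpace M] [ChartedSpace (EuclideanSpace ℝ (Fin n)) M]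
  [RiemannianBundle (fun x : M ↦ TangentSpace (𝓡 n) x)]
  [IsManifold (𝓡 n) ∞ M]
  [IsContinuousRiemannianBundle (EuclideanSpace ℝ (Fin n)) (fun x : M ↦ TangentSpace (𝓡 n) x)]

/-- A locally Lipschitz function supported in a chart, read in the chart and extended by zero. -/
theorem exists_chart_extension {h : M → ℝ} (hh : LipschitzInCharts n h) (hc : HasCompactSupport h)
    (x : M) (hs : tsupport h ⊆ (extChartAt (𝓡 n) x).source) :
    ∃ (u : EuclideanSpace ℝ (Fin n) → ℝ) (L : NNReal), LipschitzWith L u ∧ HasCompactSupport u ∧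
      tsupport u ⊆ (extChartAt (𝓡 n) x).target ∧
      ∀ y ∈ (extChartAt (𝓡 n) x).target, u y = h ((extChartAt (𝓡 n) x).symm y) := by
  classical
  set K := extChartAt (𝓡 n) x '' tsupport h with hK
  have hKc : IsCompact K := IsCompact.image_of_continuousOn hc ((continuousOn_extChartAt x).mono hs)
  have hKt : K ⊆ (extChartAt (𝓡 n) x).target := by
    rintro _ ⟨z, hz, rfl⟩
    exact (extChartAt (𝓡 n) x).map_source (hs hz)
  let u : EuclideanSpace ℝ (Fin n) → ℝ :=
    (extChartAt (𝓡 n) x).target.indicator (h ∘ (extChartAt (𝓡 n) x).symm)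
  have hu : ∀ y ∈ (extChartAt (𝓡 n) x).target, u y = h ((extChartAt (𝓡 n) x).symm y) :=
    fun y hy ↦ indicator_of_mem hy _
  have hu0 : ∀ y ∉ K, u y = 0 := by
    intro y hy
    by_cases hyt : y ∈ (extChartAt (𝓡 n) x).target
    · rw [hu y hyt]
      by_contra hne
      refine hy ⟨_, subset_tsupport h hne, (extChartAt (𝓡 n) x).right_inv hyt⟩
    · exact indicator_of_notMem hyt _
  have hsupp : Function.support u ⊆ K := fun y hy ↦ by_contra fun h' ↦ hy (hu0 y h')
  have huc : HasCompactSupport u := HasCompactSupport.of_support_subset_isCompact hKc hsupp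
  have hlip : LocallyLipschitz u := by
    intro y
    by_cases hy : y ∈ (extChartAt (𝓡 n) x).target
    · obtain ⟨C, s, hs', hC⟩ := hh x y hy
      refine ⟨C, s ∩ (extChartAt (𝓡 n) x).target,
        inter_mem hs' ((isOpen_chart_target x).mem_nhds hy), ?_⟩
      intro a ha b hb
      rw [hu a ha.2, hu b hb.2]
      exact hC ha.1 hb.1
    · refine ⟨0, Kᶜ, hKc.isClosed.isOpen_compl.mem_nhds fun h' ↦ hy (hKt h'), ?_⟩
      intro a ha b hb
      rw [hu0 a ha, hu0 b hb]
      simp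
  obtain ⟨L, hL⟩ := hlip.exists_lipschitzWith_of_hasCompactSupport huc
  exact ⟨u, L, hL, huc, (closure_minimal hsupp hKc.isClosed).trans hKt, hu⟩

variable [MeasurableSpace M] [BorelSpace M] [SecondCountableTopology M]

/-- The weak inequality for a nonnegative locally Lipschitz test function supported in a chart. -/
theorem WeakLaplacianGE.integral_le_of_tsupport_subset_source {w : M → ℝ} {c : ℝ}
    (hweak : WeakLaplacianGE n w (fun _ ↦ c)) (hw : LipschitzInCharts n w)
    {h : M → ℝ} (hh : LipschitzInCharts n h) (hc : HasCompactSupport h) (h0 : ∀ z, 0 ≤ h z)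
    (x : M) (hs : tsupport h ⊆ (extChartAt (𝓡 n) x).source) :
    ∫ z, inner ℝ (riemannianGrad n w z) (riemannianGrad n h z) ∂(riemannianVolume n M) ≤
      -∫ z, c * h z ∂(riemannianVolume n M) := by
  classical
  obtain ⟨u, L, hL, huc, hut, hu⟩ := exists_chart_extension hh hc x hs
  have hu0 : ∀ y, 0 ≤ u y := by
    intro y
    by_cases hy : y ∈ (extChartAt (𝓡 n) x).target
    · rw [hu y hy]
      exact h0 _
    · rw [image_eq_zero_of_notMem_tsupport fun h' ↦ hy (hut h')]
  -- The thickened support still lies in the chart, so the mollifications, carried to `M` and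
  -- extended by zero, are smooth with supports in one compact set `S`.
  obtain ⟨δ, hδ, hδt⟩ :=
    IsCompact.exists_cthickening_subset_open huc (isOpen_chart_target x) hut
  obtain ⟨g, hg, hg0, hgs, ⟨B, hB⟩, hgL, hgt, hgd⟩ := exists_contDiff_approximation hL huc hu0 hδ
  set K := cthickening δ (tsupport u) with hK
  have hKc : IsCompact K := IsCompact.cthickening huc
  set S := (extChartAt (𝓡 n) x).symm '' K with hS
  have hSc : IsCompact S := hKc.image_of_continuousOn ((continuousOn_extChartAt_symm x).mono hδt)
  have hSs : S ⊆ (extChartAt (𝓡 n) x).source := by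
    rintro _ ⟨y, hy, rfl⟩
    exact (extChartAt (𝓡 n) x).map_target (hδt hy)
  let H : ℕ → M → ℝ := fun k ↦ (extChartAt (𝓡 n) x).source.indicator (g k ∘ extChartAt (𝓡 n) x)
  have hH : ∀ k, ∀ z ∈ (extChartAt (𝓡 n) x).source, H k z = g k (extChartAt (𝓡 n) x z) :=
    fun k z hz ↦ indicator_of_mem hz _
  have hHS : ∀ k, ∀ z ∉ S, H k z = 0 := by
    intro k z hz
    by_cases hzs : z ∈ (extChartAt (𝓡 n) x).source
    · rw [hH k z hzs]
      by_contra hne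
      exact hz ⟨_, hgs k hne, (extChartAt (𝓡 n) x).left_inv hzs⟩
    · exact indicator_of_notMem hzs _
  have hHS' : ∀ k, ∀ z ∉ S, H k =ᶠ[𝓝 z] 0 := by
    intro k z hz
    filter_upwards [hSc.isClosed.isOpen_compl.mem_nhds hz] with a ha using hHS k a ha
  have hhS : ∀ z ∉ S, h z = 0 := by
    intro z hz
    by_contra hne
    have hzs := hs (subset_tsupport h hne)
    refine hz ⟨extChartAt (𝓡 n) x z, ?_, (extChartAt (𝓡 n) x).left_inv hzs⟩
    refine self_subset_cthickening _ (subset_tsupport u ?_)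
    rw [Function.mem_support, hu _ ((extChartAt (𝓡 n) x).map_source hzs),
      (extChartAt (𝓡 n) x).left_inv hzs]
    exact hne
  have hhS' : ∀ z ∉ S, h =ᶠ[𝓝 z] 0 := by
    intro z hz
    filter_upwards [hSc.isClosed.isOpen_compl.mem_nhds hz] with a ha using hhS a ha
  have hHsmooth : ∀ k, ContMDiff (𝓡 n) 𝓘(ℝ, ℝ) ∞ (H k) := by
    intro k z
    by_cases hz : z ∈ (extChartAt (𝓡 n) x).source
    · have h1 : ContMDiffAt (𝓡 n) 𝓘(ℝ, ℝ) ∞ (g k ∘ extChartAt (𝓡 n) x) z := by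
        refine (hg k).contMDiff.contMDiffAt.comp z (contMDiffAt_extChartAt' ?_)
        rwa [extChartAt_source] at hz
      refine h1.congr_of_eventuallyEq ?_
      filter_upwards [(isOpen_extChartAt_source (I := 𝓡 n) x).mem_nhds hz] with a ha
        using hH k a ha
    · exact contMDiffAt_const.congr_of_eventuallyEq (hHS' k z fun h' ↦ hz (hSs h'))
  have hHc : ∀ k, HasCompactSupport (H k) := fun k ↦
    HasCompactSupport.of_support_subset_isCompact hSc
      fun z hz ↦ by_contra fun h' ↦ hz (hHS k z h')
  have hHnn : ∀ k z, 0 ≤ H k z := fun k z ↦ indicator_nonneg (fun a _ ↦ hg0 k _) z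
  have hineq := fun k ↦ hweak (H k) (hHsmooth k) (hHc k) (hHnn k)
  have hHder : ∀ k, ∀ y ∈ (extChartAt (𝓡 n) x).target,
      fderiv ℝ (H k ∘ (extChartAt (𝓡 n) x).symm) y = fderiv ℝ (g k) y := by
    intro k y hy
    refine Filter.EventuallyEq.fderiv_eq ?_
    filter_upwards [(isOpen_chart_target x).mem_nhds hy] with a ha
    rw [Function.comp_apply, hH k _ ((extChartAt (𝓡 n) x).map_target ha),
      (extChartAt (𝓡 n) x).right_inv ha]
  have hhder : ∀ y ∈ (extChartAt (𝓡 n) x).target,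
      fderiv ℝ (h ∘ (extChartAt (𝓡 n) x).symm) y = fderiv ℝ u y := by
    intro y hy
    refine Filter.EventuallyEq.fderiv_eq ?_
    filter_upwards [(isOpen_chart_target x).mem_nhds hy] with a ha
    rw [Function.comp_apply, hu a ha]
  have hSfin : riemannianVolume n M S < ⊤ := hSc.measure_lt_top
  obtain ⟨C₁, hC₁⟩ := hw.exists_norm_riemannianGrad_le hSc
  -- The bound is uniform in `k`: the mollified derivatives are bounded by `L`, and `G⁻¹` is bounded
  -- on the compact set `K`.
  obtain ⟨C₂, hC₂⟩ : ∃ C₂, ∀ k, ∀ z ∈ S, ‖riemannianGrad n (H k) z‖ ≤ C₂ := by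
    have hcont : ContinuousOn (fun y ↦ ∑ i, ∑ j, |(chartGram (n := n) x y)⁻¹ i j|) K :=
      ContinuousOn.mono (continuousOn_finsetSum _ fun i _ ↦ continuousOn_finsetSum _ fun j _ ↦
        (continuousOn_pi.1 (continuousOn_pi.1 (continuousOn_chartGram_inv (n := n) x) i) j).abs)
        hδt
    obtain ⟨N, hN⟩ := hKc.exists_bound_of_continuousOn hcont
    refine ⟨Real.sqrt (N * L ^ 2), ?_⟩
    rintro k _ ⟨y, hy, rfl⟩
    apply Real.le_sqrt_of_sq_le
    refine (sq_norm_riemannianGrad_le x (hδt hy) (H k)).trans ?_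
    rw [hHder k y (hδt hy)]
    have h1 := (Real.le_norm_self _).trans (hN y hy)
    have h2 := hgL k y
    have h3 : 0 ≤ N := (norm_nonneg _).trans (hN y hy)
    gcongr
  have lim1 : Tendsto (fun k ↦ ∫ z, inner ℝ (riemannianGrad n w z) (riemannianGrad n (H k) z)
      ∂(riemannianVolume n M)) atTop
      (𝓝 (∫ z, inner ℝ (riemannianGrad n w z) (riemannianGrad n h z)
        ∂(riemannianVolume n M))) := by
    refine tendsto_integral_of_dominated_convergence (S.indicator fun _ ↦ C₁ * C₂)
      (fun k ↦ aestronglyMeasurable_inner_riemannianGrad w (H k)) ?_ ?_ ?_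
    · rw [integrable_indicator_iff hSc.measurableSet]
      exact integrableOn_const hSfin.ne
    · refine fun k ↦ Eventually.of_forall fun z ↦ ?_
      by_cases hz : z ∈ S
      · rw [indicator_of_mem hz]
        refine (norm_inner_le_norm _ _).trans ?_
        exact mul_le_mul (hC₁ z hz) (hC₂ k z hz) (norm_nonneg _) ((norm_nonneg _).trans (hC₁ z hz))
      · rw [indicator_of_notMem hz, riemannianGrad_eq_zero_of_eventuallyEq (hHS' k z hz),
          inner_zero_right, norm_zero]
    · have hsrc : ∀ᵐ z ∂(riemannianVolume n M), z ∈ (extChartAt (𝓡 n) x).source →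
          Tendsto (fun k ↦ inner ℝ (riemannianGrad n w z) (riemannianGrad n (H k) z)) atTop
            (𝓝 (inner ℝ (riemannianGrad n w z) (riemannianGrad n h z))) := by
        refine ae_mem_source_of_ae_chart x ?_
        filter_upwards [hgd] with y hy hyt
        have hd : ∀ i, Tendsto (fun k ↦ chartDeriv x (H k) y i) atTop
            (𝓝 (chartDeriv x h y i)) := by
          intro i
          simp only [chartDeriv, hHder _ y hyt, hhder y hyt]
          exact ((ContinuousLinearMap.apply ℝ ℝ
            (EuclideanSpace.single i (1 : ℝ))).continuous.tendsto _).comp hy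
        simp only [inner_riemannianGrad_chart x hyt]
        simp only [dotProduct, Matrix.mulVec]
        refine tendsto_finsetSum _ fun i _ ↦ Tendsto.const_mul _ ?_
        exact tendsto_finsetSum _ fun j _ ↦ Tendsto.const_mul _ (hd j)
      filter_upwards [hsrc] with z hz
      by_cases hzs : z ∈ (extChartAt (𝓡 n) x).source
      · exact hz hzs
      · have hzS : z ∉ S := fun h' ↦ hzs (hSs h')
        rw [riemannianGrad_eq_zero_of_eventuallyEq (hhS' z hzS)]
        refine tendsto_const_nhds.congr fun k ↦ ?_
        rw [riemannianGrad_eq_zero_of_eventuallyEq (hHS' k z hzS)]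
  have lim2 : Tendsto (fun k ↦ ∫ z, c * H k z ∂(riemannianVolume n M)) atTop
      (𝓝 (∫ z, c * h z ∂(riemannianVolume n M))) := by
    refine tendsto_integral_of_dominated_convergence (S.indicator fun _ ↦ |c| * B)
      (fun k ↦ (continuous_const.mul (hHsmooth k).continuous).aestronglyMeasurable) ?_ ?_ ?_
    · rw [integrable_indicator_iff hSc.measurableSet]
      exact integrableOn_const hSfin.ne
    · refine fun k ↦ Eventually.of_forall fun z ↦ ?_
      by_cases hz : z ∈ S
      · rw [indicator_of_mem hz, hH k z (hSs hz), norm_mul, Real.norm_eq_abs, Real.norm_eq_abs]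
        gcongr
        exact hB k _
      · rw [indicator_of_notMem hz, hHS k z hz, mul_zero, norm_zero]
    · refine Eventually.of_forall fun z ↦ Tendsto.const_mul _ ?_
      by_cases hz : z ∈ S
      · simp only [hH _ z (hSs hz)]
        have := hu _ ((extChartAt (𝓡 n) x).map_source (hSs hz))
        rw [(extChartAt (𝓡 n) x).left_inv (hSs hz)] at this
        rw [← this]
        exact hgt _
      · rw [hhS z hz]
        exact tendsto_const_nhds.congr fun k ↦ (hHS k z hz).symm
  exact le_of_tendsto_of_tendsto' lim1 lim2.neg hineq

theorem LipschitzInCharts.integrable_inner_riemannianGrad {w h : M → ℝ} (hw : LipschitzInCharts n w)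
    (hh : LipschitzInCharts n h) (hc : HasCompactSupport h) :
    Integrable (fun z ↦ inner ℝ (riemannianGrad n w z) (riemannianGrad n h z))
      (riemannianVolume n M) := by
  have hc' : IsCompact (tsupport h) := hc
  obtain ⟨C₁, hC₁⟩ := hw.exists_norm_riemannianGrad_le hc'
  obtain ⟨C₂, hC₂⟩ := hh.exists_norm_riemannianGrad_le hc'
  refine Integrable.mono' (g := (tsupport h).indicator fun _ ↦ C₁ * C₂) ?_
    (aestronglyMeasurable_inner_riemannianGrad w h) (Eventually.of_forall fun z ↦ ?_)
  · rw [integrable_indicator_iff hc'.measurableSet]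
    exact integrableOn_const hc'.measure_lt_top.ne
  · by_cases hz : z ∈ tsupport h
    · rw [indicator_of_mem hz]
      refine (norm_inner_le_norm _ _).trans ?_
      exact mul_le_mul (hC₁ z hz) (hC₂ z hz) (norm_nonneg _) ((norm_nonneg _).trans (hC₁ z hz))
    · rw [indicator_of_notMem hz, riemannianGrad_eq_zero_of_eventuallyEq
        (notMem_tsupport_iff_eventuallyEq.1 hz), inner_zero_right, norm_zero]

theorem LipschitzInCharts.mul {f g : M → ℝ} (hf : LipschitzInCharts n f)
    (hg : LipschitzInCharts n g) : LipschitzInCharts n fun z ↦ f z * g z :=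
  hf.comp₂ hg fun _ ↦ ⟨fun p ↦ p.1 * p.2, (contDiff_fst.mul contDiff_snd).contDiffAt,
    EventuallyEq.rfl⟩

theorem LipschitzInCharts.add {f g : M → ℝ} (hf : LipschitzInCharts n f)
    (hg : LipschitzInCharts n g) : LipschitzInCharts n fun z ↦ f z + g z :=
  hf.comp₂ hg fun _ ↦ ⟨fun p ↦ p.1 + p.2, (contDiff_fst.add contDiff_snd).contDiffAt,
    EventuallyEq.rfl⟩

theorem ContMDiff.lipschitzInCharts {f : M → ℝ} (hf : ContMDiff (𝓡 n) 𝓘(ℝ, ℝ) ∞ f) :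
    LipschitzInCharts n f := by
  intro x y hy
  have h1 : ContMDiffAt 𝓘(ℝ, EuclideanSpace ℝ (Fin n)) (𝓡 n) 1 (extChartAt (𝓡 n) x).symm y :=
    (contMDiffOn_extChartAt_symm x).contMDiffAt ((isOpen_chart_target x).mem_nhds hy)
  have h2 : ContDiffAt ℝ 1 (f ∘ (extChartAt (𝓡 n) x).symm) y :=
    (((hf.of_le (by simp)).contMDiffAt (x := (extChartAt (𝓡 n) x).symm y)).comp y h1).contDiffAt
  exact h2.exists_lipschitzOnWith

/-- The weak inequality for nonnegative locally Lipschitz test functions with compact support. -/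
theorem WeakLaplacianGE.integral_le {w : M → ℝ} {c : ℝ}
    (hweak : WeakLaplacianGE n w (fun _ ↦ c)) (hw : LipschitzInCharts n w)
    {h : M → ℝ} (hh : LipschitzInCharts n h) (hc : HasCompactSupport h) (h0 : ∀ z, 0 ≤ h z) :
    ∫ z, inner ℝ (riemannianGrad n w z) (riemannianGrad n h z) ∂(riemannianVolume n M) ≤
      -∫ z, c * h z ∂(riemannianVolume n M) := by
  classical
  have hc' : IsCompact (tsupport h) := hc
  have : LocallyCompactSpace M :=
    ChartedSpace.locallyCompactSpace (EuclideanSpace ℝ (Fin n)) M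
  obtain ⟨χ, hχ⟩ := SmoothPartitionOfUnity.exists_isSubordinate_chartAt_source_of_isClosed
    (𝓡 n) (isClosed_tsupport h)
  -- By local finiteness only finitely many members of the partition meet the support of `h`, so `h`
  -- is a finite sum of pieces `χᵢ h`, each supported in a chart.
  have hfin := χ.locallyFinite.finite_nonempty_inter_compact hc'
  set I := hfin.toFinset with hI
  have hχl : ∀ i, LipschitzInCharts n (χ i) := fun i ↦ (χ i).contMDiff.lipschitzInCharts
  have hpl : ∀ i, LipschitzInCharts n fun z ↦ χ i z * h z := fun i ↦ (hχl i).mul hh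
  have hpc : ∀ i, HasCompactSupport fun z ↦ χ i z * h z := fun i ↦ hc.mul_left
  have hpiece : ∀ i, ∫ z, inner ℝ (riemannianGrad n w z)
      (riemannianGrad n (fun z ↦ χ i z * h z) z) ∂(riemannianVolume n M) ≤
      -∫ z, c * (χ i z * h z) ∂(riemannianVolume n M) := by
    intro i
    refine hweak.integral_le_of_tsupport_subset_source hw (hpl i) (hpc i)
      (fun z ↦ mul_nonneg (χ.nonneg i z) (h0 z)) i ?_
    rw [extChartAt_source]
    exact (closure_mono (Function.support_mul_subset_left _ _)).trans (hχ i)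
  have hsum : ∀ J : Finset (tsupport h), LipschitzInCharts n (fun z ↦ ∑ i ∈ J, χ i z * h z) ∧
      HasCompactSupport (fun z ↦ ∑ i ∈ J, χ i z * h z) ∧
      ∫ z, inner ℝ (riemannianGrad n w z)
        (riemannianGrad n (fun z ↦ ∑ i ∈ J, χ i z * h z) z) ∂(riemannianVolume n M) ≤
      -∫ z, c * (∑ i ∈ J, χ i z * h z) ∂(riemannianVolume n M) := by
    intro J
    induction J using Finset.induction_on with
    | empty =>
      simp only [Finset.sum_empty]
      refine ⟨contMDiff_const.lipschitzInCharts, HasCompactSupport.zero, ?_⟩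
      have : ∀ z, riemannianGrad n (fun _ : M ↦ (0 : ℝ)) z = 0 := fun z ↦
        riemannianGrad_eq_zero_of_eventuallyEq EventuallyEq.rfl
      simp [this]
    | insert i J hi ih =>
      obtain ⟨ih1, ih2, ih3⟩ := ih
      simp only [Finset.sum_insert hi]
      refine ⟨(hpl i).add ih1, (hpc i).add ih2, ?_⟩
      have e1 : ∫ z, inner ℝ (riemannianGrad n w z)
          (riemannianGrad n (fun z ↦ χ i z * h z + ∑ j ∈ J, χ j z * h z) z)
          ∂(riemannianVolume n M) =
          ∫ z, (inner ℝ (riemannianGrad n w z) (riemannianGrad n (fun z ↦ χ i z * h z) z) +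
            inner ℝ (riemannianGrad n w z)
              (riemannianGrad n (fun z ↦ ∑ j ∈ J, χ j z * h z) z)) ∂(riemannianVolume n M) := by
        refine integral_congr_ae ?_
        filter_upwards [(hpl i).ae_mdifferentiableAt, ih1.ae_mdifferentiableAt] with z h1 h2
        rw [riemannianGrad_add h1 h2, inner_add_right]
      have e2 : ∫ z, c * (χ i z * h z + ∑ j ∈ J, χ j z * h z) ∂(riemannianVolume n M) =
          ∫ z, c * (χ i z * h z) ∂(riemannianVolume n M) +
            ∫ z, c * (∑ j ∈ J, χ j z * h z) ∂(riemannianVolume n M) := by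
        simp only [mul_add]
        exact integral_add
          (((hpl i).continuous.integrable_of_hasCompactSupport (hpc i)).const_mul c)
          ((ih1.continuous.integrable_of_hasCompactSupport ih2).const_mul c)
      rw [e1, e2, integral_add (hw.integrable_inner_riemannianGrad (hpl i) (hpc i))
        (hw.integrable_inner_riemannianGrad ih1 ih2)]
      linarith [hpiece i]
  have hfinal : (fun z ↦ ∑ i ∈ I, χ i z * h z) = h := by
    ext z
    by_cases hz : z ∈ tsupport h
    · rw [← Finset.sum_mul, χ.sum_finsupport' z hz, one_mul]
      intro i hi
      rw [hI, Set.Finite.mem_toFinset]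
      exact ⟨z, (χ.mem_finsupport z).1 hi, hz⟩
    · simp [image_eq_zero_of_notMem_tsupport hz]
  have := (hsum I).2.2
  have hfz : ∀ z, ∑ i ∈ I, χ i z * h z = h z := congrFun hfinal
  rw [hfinal] at this
  simpa only [hfz] using this

end LipschitzTest

/-! ### The model equation and its hypergeometric solution. -/

section ModelEquation

open Set Filter Topology

/-- The denominators `k! ν (ν + 1) ⋯ (ν + k - 1)` of the confluent hypergeometric limit series. -/
noncomputable def hypDenom (ν : ℝ) (k : ℕ) : ℝ := ∏ j ∈ Finset.range k, ((j + 1) * (ν + j))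

/-- The confluent hypergeometric limit function `₀F₁(; ν; z)`. -/
noncomputable def hypLimit (ν z : ℝ) : ℝ := ∑' k : ℕ, z ^ k / hypDenom ν k

theorem hypDenom_succ (ν : ℝ) (k : ℕ) :
    hypDenom ν (k + 1) = hypDenom ν k * ((k + 1) * (ν + k)) :=
  Finset.prod_range_succ _ _

theorem hypDenom_succ' (ν : ℝ) (k : ℕ) :
    hypDenom ν (k + 1) = (k + 1) * ν * hypDenom (ν + 1) k := by
  induction k with
  | zero => simp [hypDenom]
  | succ k ih =>
    rw [hypDenom_succ, ih, hypDenom_succ (ν + 1)]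
    push_cast
    ring

theorem hypDenom_pos {ν : ℝ} (hν : 0 < ν) (k : ℕ) : 0 < hypDenom ν k :=
  Finset.prod_pos fun j _ ↦ by positivity

theorem factorial_mul_pow_le_hypDenom {ν : ℝ} (hν : 0 < ν) (k : ℕ) :
    ν ^ k * k.factorial ≤ hypDenom ν k := by
  induction k with
  | zero => simp [hypDenom]
  | succ k ih =>
    rw [hypDenom_succ, pow_succ, Nat.factorial_succ]
    push_cast
    calc ν ^ k * ν * ((k + 1) * k.factorial) = (ν ^ k * k.factorial) * ((k + 1) * ν) := by ring
      _ ≤ hypDenom ν k * ((k + 1) * (ν + k)) := by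
        gcongr
        · exact (hypDenom_pos hν k).le
        · simp

theorem summable_hypLimit {ν : ℝ} (hν : 0 < ν) (z : ℝ) :
    Summable fun k : ℕ ↦ z ^ k / hypDenom ν k := by
  refine Summable.of_norm_bounded (Real.summable_pow_div_factorial (|z| / ν)) fun k ↦ ?_
  rw [norm_div, norm_pow, Real.norm_eq_abs, Real.norm_of_nonneg (hypDenom_pos hν k).le, div_pow,
    div_div]
  gcongr
  exact factorial_mul_pow_le_hypDenom hν k

theorem hypLimit_zero (ν : ℝ) : hypLimit ν 0 = 1 := by
  rw [hypLimit, tsum_eq_single 0]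
  · simp [hypDenom]
  · intro k hk
    simp [hk]

theorem succ_div_hypDenom {ν : ℝ} (k : ℕ) (z : ℝ) :
    ((k + 1 : ℕ) : ℝ) * z ^ k / hypDenom ν (k + 1) = z ^ k / hypDenom (ν + 1) k / ν := by
  rw [hypDenom_succ']
  have : ((k + 1 : ℕ) : ℝ) ≠ 0 := by positivity
  push_cast at this ⊢
  rw [mul_assoc, mul_div_mul_left _ _ this, div_div, mul_comm ν]

/-- Termwise differentiation: lowering the power is absorbed by raising `ν` by one, so all
derivatives stay in the same family. -/
theorem hasDerivAt_hypLimit {ν : ℝ} (hν : 0 < ν) (z : ℝ) :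
    HasDerivAt (hypLimit ν) (hypLimit (ν + 1) z / ν) z := by
  set R := |z| + 1
  have hR : 0 < R := by positivity
  have hsum : ∀ y : ℝ, Summable fun k : ℕ ↦ (k : ℝ) * y ^ (k - 1) / hypDenom ν k := by
    intro y
    rw [← summable_nat_add_iff 1]
    simp only [Nat.add_sub_cancel, succ_div_hypDenom]
    exact (summable_hypLimit (by positivity) y).div_const ν
  have hz : z ∈ Metric.ball (0 : ℝ) R := by simp [R]
  have h := hasDerivAt_tsum_of_isPreconnected (hsum R) Metric.isOpen_ball
    (convex_ball (0 : ℝ) R).isPreconnected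
    (g := fun (k : ℕ) (y : ℝ) ↦ y ^ k / hypDenom ν k)
    (g' := fun (k : ℕ) (y : ℝ) ↦ (k : ℝ) * y ^ (k - 1) / hypDenom ν k)
    (fun k y _ ↦ (hasDerivAt_pow k y).div_const _) (fun k y hy ↦ ?_) hz
    (summable_hypLimit hν z) hz
  · convert! h using 1
    rw [(hsum z).tsum_eq_zero_add]
    simp only [Nat.cast_zero, zero_mul, zero_div, zero_add, Nat.add_sub_cancel, succ_div_hypDenom]
    rw [tsum_div_const]
    rfl
  · rw [norm_div, norm_mul, norm_pow, Real.norm_of_nonneg (hypDenom_pos hν k).le, RCLike.norm_natCast]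
    have : ‖y‖ ≤ R := (mem_ball_zero_iff.1 hy).le
    have := (hypDenom_pos hν k).le
    gcongr

theorem continuous_hypLimit {ν : ℝ} (hν : 0 < ν) : Continuous (hypLimit ν) :=
  continuous_iff_continuousAt.2 fun z ↦ (hasDerivAt_hypLimit hν z).continuousAt

theorem inv_hypDenom_succ_sub {ν : ℝ} (hν : 0 < ν) (k : ℕ) :
    (hypDenom ν (k + 1))⁻¹ =
      (hypDenom (ν + 1) (k + 1))⁻¹ + (ν * (ν + 1))⁻¹ * (hypDenom (ν + 1 + 1) k)⁻¹ := by
  have h1 : 0 < ν + 1 := by positivity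
  have hk : (k : ℝ) + 1 ≠ 0 := by positivity
  have hk' : ν + 1 + k ≠ 0 := by positivity
  have e1 := hypDenom_succ (ν + 1) k
  have e2 := hypDenom_succ' (ν + 1) k
  have p1 := (hypDenom_pos h1 k).ne'
  have e3 : hypDenom (ν + 1 + 1) k = hypDenom (ν + 1) k * (ν + 1 + k) / (ν + 1) := by
    rw [eq_div_iff h1.ne']
    apply mul_left_cancel₀ hk
    linear_combination e1 - e2
  rw [hypDenom_succ' ν, e1, e3]
  generalize hypDenom (ν + 1) k = d at p1
  field_simp
  ring

theorem hypLimit_eq_one_add {ν : ℝ} (hν : 0 < ν) (z : ℝ) :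
    hypLimit ν z = 1 + ∑' k : ℕ, z ^ (k + 1) / hypDenom ν (k + 1) := by
  unfold hypLimit
  rw [(summable_hypLimit hν z).tsum_eq_zero_add]
  simp [hypDenom]

/-- As the derivatives of `hypLimit ν` are multiples of the functions of parameters `ν + 1` and `ν +
2`, this three-term relation is the differential equation in disguise. -/
theorem hypLimit_contiguous {ν : ℝ} (hν : 0 < ν) (z : ℝ) :
    hypLimit ν z = hypLimit (ν + 1) z + z / (ν * (ν + 1)) * hypLimit (ν + 1 + 1) z := by
  have h1 : 0 < ν + 1 := by positivity
  have h2 : 0 < ν + 1 + 1 := by positivity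
  have s1 : Summable fun k : ℕ ↦ z ^ (k + 1) / hypDenom (ν + 1) (k + 1) :=
    (summable_nat_add_iff (f := fun k : ℕ ↦ z ^ k / hypDenom (ν + 1) k) 1).2
      (summable_hypLimit h1 z)
  have s2 : Summable fun k : ℕ ↦ z / (ν * (ν + 1)) * (z ^ k / hypDenom (ν + 1 + 1) k) :=
    (summable_hypLimit h2 z).mul_left _
  rw [hypLimit_eq_one_add hν, hypLimit_eq_one_add h1, add_assoc, hypLimit, ← tsum_mul_left,
    ← s1.tsum_add s2]
  congr 1
  refine tsum_congr fun k ↦ ?_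
  simp only [div_eq_mul_inv, inv_hypDenom_succ_sub hν k]
  ring

section Profile

variable {ν κ : ℝ}

theorem hasDerivAt_hypLimit_comp (hν : 0 < ν) (κ t : ℝ) :
    HasDerivAt (fun t ↦ hypLimit ν (-κ * t)) (-(κ / ν) * hypLimit (ν + 1) (-κ * t)) t := by
  have h := (hasDerivAt_hypLimit hν (-κ * t)).comp t ((hasDerivAt_id t).const_mul (-κ))
  convert! h using 1
  simp
  ring

/-- By the contiguous relation, `s^ν hypLimit (ν + 1) (-κ s)` has derivative `ν s^(ν-1) hypLimit ν
(-κ s) ≥ 0`, and it vanishes at `0`. -/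
theorem hypLimit_succ_nonneg (hν : 0 < ν) {c : ℝ}
    (h : ∀ t ∈ Icc 0 c, 0 ≤ hypLimit ν (-κ * t)) :
    ∀ t ∈ Icc 0 c, 0 ≤ hypLimit (ν + 1) (-κ * t) := by
  intro t ht
  rcases ht.1.eq_or_lt with rfl | ht0
  · simp [hypLimit_zero]
  have h1 : 0 < ν + 1 := by positivity
  have hmono : MonotoneOn (fun s ↦ s ^ ν * hypLimit (ν + 1) (-κ * s)) (Icc 0 c) := by
    refine monotoneOn_of_deriv_nonneg (convex_Icc 0 c) ?_ ?_ ?_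
    · exact ((Real.continuous_rpow_const hν.le).mul
        ((continuous_hypLimit h1).comp (continuous_const.mul continuous_id))).continuousOn
    · rw [interior_Icc]
      intro s hs
      exact ((Real.hasDerivAt_rpow_const (Or.inl hs.1.ne')).mul
        (hasDerivAt_hypLimit_comp h1 κ s)).differentiableAt.differentiableWithinAt
    · rw [interior_Icc]
      intro s hs
      have hd := (Real.hasDerivAt_rpow_const (p := ν) (Or.inl hs.1.ne')).mul
        (hasDerivAt_hypLimit_comp h1 κ s)
      rw [show (fun s ↦ s ^ ν * hypLimit (ν + 1) (-κ * s)) =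
        (fun s ↦ s ^ ν) * fun s ↦ hypLimit (ν + 1) (-κ * s) from rfl, hd.deriv]
      have hs1 : s ^ ν = s ^ (ν - 1) * s := by
        rw [← Real.rpow_add_one hs.1.ne', sub_add_cancel]
      have hc := hypLimit_contiguous hν (-κ * s)
      have key : ν * s ^ (ν - 1) * hypLimit (ν + 1) (-κ * s) +
          s ^ ν * (-(κ / (ν + 1)) * hypLimit (ν + 1 + 1) (-κ * s)) =
          ν * s ^ (ν - 1) * hypLimit ν (-κ * s) := by
        rw [hc, hs1]
        field_simp
      rw [key]
      exact mul_nonneg (mul_nonneg hν.le (Real.rpow_nonneg hs.1.le _))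
        (h s (Ioo_subset_Icc_self hs))
  have := hmono (left_mem_Icc.2 (ht.1.trans ht.2)) ht ht.1
  simp only [Real.zero_rpow hν.ne', zero_mul] at this
  exact nonneg_of_mul_nonneg_right this (Real.rpow_pos_of_pos ht0 ν)

/-- Below the first eigenvalue of the model, the radial solution has no zero. -/
theorem hypLimit_pos_of_lt_modelEigenvalue {μ : ℝ} (hμ : 0 < μ) (hκ : 0 < κ)
    (h : 4 * κ < modelEigenvalue μ) : ∀ t ∈ Icc (0 : ℝ) 1, 0 < hypLimit (μ / 2) (-κ * t) := by
  have hν : 0 < μ / 2 := by positivity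
  have hν1 : 0 < μ / 2 + 1 := by positivity
  have hν2 : 0 < μ / 2 + 1 + 1 := by positivity
  set F : ℝ → ℝ := fun t ↦ hypLimit (μ / 2) (-κ * t) with hF
  set F₁ : ℝ → ℝ := fun t ↦ -(κ / (μ / 2)) * hypLimit (μ / 2 + 1) (-κ * t) with hF₁
  set F₂ : ℝ → ℝ := fun t ↦ -(κ / (μ / 2)) *
    (-(κ / (μ / 2 + 1)) * hypLimit (μ / 2 + 1 + 1) (-κ * t)) with hF₂
  have dF : ∀ t, HasDerivAt F (F₁ t) t := fun t ↦ hasDerivAt_hypLimit_comp hν κ t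
  have dF₁ : ∀ t, HasDerivAt F₁ (F₂ t) t := fun t ↦
    (hasDerivAt_hypLimit_comp hν1 κ t).const_mul _
  have cF : Continuous F := continuous_iff_continuousAt.2 fun t ↦ (dF t).continuousAt
  have cF₁ : Continuous F₁ := continuous_iff_continuousAt.2 fun t ↦ (dF₁ t).continuousAt
  have ode : ∀ t, 4 * t * F₂ t + 2 * μ * F₁ t = -(4 * κ) * F t := by
    intro t
    simp only [hF, hF₁, hF₂, hypLimit_contiguous hν (-κ * t)]
    field_simp
    ring
  by_contra! hcon
  obtain ⟨t, ht, htF⟩ := hcon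
  obtain ⟨t₀, ht₀, hFt₀⟩ : ∃ t₀ ∈ Icc 0 t, F t₀ = 0 := by
    have := intermediate_value_Icc' ht.1 cF.continuousOn
    refine this ⟨htF, ?_⟩
    simp [hF, hypLimit_zero]
  have ht₀0 : 0 < t₀ := by
    rcases ht₀.1.eq_or_lt with h0 | h0
    · rw [← h0] at hFt₀
      simp [hF, hypLimit_zero] at hFt₀
    · exact h0
  set s₀ := Real.sqrt t₀ with hs₀
  have hs₀0 : 0 < s₀ := Real.sqrt_pos.2 ht₀0
  have hs₀1 : s₀ ≤ 1 := by
    refine Real.sqrt_le_iff.2 ⟨zero_le_one, ?_⟩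
    rw [one_pow]
    exact ht₀.2.trans ht.2
  have hs₀F : F (s₀ ^ 2) = 0 := by rw [hs₀, Real.sq_sqrt ht₀0.le, hFt₀]
  -- A zero `s₀` of `u(s) = F(s²)` yields an admissible function for `modelEigenvalue μ`: `u` up to
  -- `s₀`, zero afterwards. Its quotient will be at most `4κ`.
  set ψ : ℝ → ℝ := fun s ↦ F (min s s₀ ^ 2) with hψ
  have dFsq : ∀ s, HasDerivAt (fun s ↦ F (s ^ 2)) (2 * s * F₁ (s ^ 2)) s := by
    intro s
    have := (dF (s ^ 2)).comp s (hasDerivAt_pow 2 s)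
    convert! this using 1
    simp
    ring
  have dF₁sq : ∀ s, HasDerivAt (fun s ↦ F₁ (s ^ 2)) (2 * s * F₂ (s ^ 2)) s := by
    intro s
    have := (dF₁ (s ^ 2)).comp s (hasDerivAt_pow 2 s)
    convert! this using 1
    simp
    ring
  have hLip : ∃ K, LipschitzOnWith K ψ (Icc 0 1) := by
    have hC1 : ContDiff ℝ 1 fun s ↦ F (s ^ 2) := by
      refine contDiff_one_iff_deriv.2 ⟨fun s ↦ (dFsq s).differentiableAt, ?_⟩
      rw [show deriv (fun s ↦ F (s ^ 2)) = fun s ↦ 2 * s * F₁ (s ^ 2) from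
        funext fun s ↦ (dFsq s).deriv]
      fun_prop
    obtain ⟨K, hK⟩ := hC1.locallyLipschitz.locallyLipschitzOn.exists_lipschitzOnWith_of_compact
      (isCompact_Icc (a := (0 : ℝ)) (b := 1))
    have hmin : LipschitzWith 1 fun s : ℝ ↦ min s s₀ := LipschitzWith.id.min_const s₀
    refine ⟨K * 1, hK.comp (hmin.lipschitzOnWith (s := Icc 0 1)) fun s hs ↦ ?_⟩
    exact ⟨le_min hs.1 hs₀0.le, (min_le_left _ _).trans hs.2⟩
  have hψ_lt : ∀ s, s < s₀ → ψ s = F (s ^ 2) := fun s hs ↦ by simp only [hψ, min_eq_left hs.le]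
  have hψ_gt : ∀ s, s₀ < s → ψ s = 0 := fun s hs ↦ by simp only [hψ, min_eq_right hs.le, hs₀F]
  have hdψ_lt : ∀ s, s < s₀ → deriv ψ s = 2 * s * F₁ (s ^ 2) := by
    intro s hs
    rw [← (dFsq s).deriv]
    refine Filter.EventuallyEq.deriv_eq ?_
    filter_upwards [Iio_mem_nhds hs] with a ha using hψ_lt a ha
  have hdψ_gt : ∀ s, s₀ < s → deriv ψ s = 0 := by
    intro s hs
    have : ψ =ᶠ[𝓝 s] fun _ ↦ 0 := by
      filter_upwards [Ioi_mem_nhds hs] with a ha using hψ_gt a ha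
    rw [this.deriv_eq, deriv_const]
  have hcut : ∀ a b : ℝ → ℝ, (∀ s ∈ Ioo 0 s₀, a s = b s) → (∀ s, s₀ < s → a s = 0) →
      ∫ s in (0 : ℝ)..1, a s = ∫ s in (0 : ℝ)..s₀, b s := by
    intro a b hab ha
    rw [intervalIntegral.integral_of_le zero_le_one, intervalIntegral.integral_of_le hs₀0.le,
      integral_Ioc_eq_integral_Ioo, integral_Ioc_eq_integral_Ioo,
      ← setIntegral_congr_fun measurableSet_Ioo hab]
    refine setIntegral_eq_of_subset_of_ae_sdiff_eq_zero measurableSet_Ioo.nullMeasurableSet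
      (Ioo_subset_Ioo_right hs₀1) ?_
    have hne : ∀ᵐ s : ℝ, s ≠ s₀ := by simp [ae_iff]
    filter_upwards [hne] with s hs hs'
    refine ha s (lt_of_le_of_ne ?_ (Ne.symm hs))
    by_contra hlt
    exact hs'.2 ⟨hs'.1.1, not_le.1 hlt⟩
  have hnum : ∫ s in (0 : ℝ)..1, |deriv ψ s| ^ 2 * s ^ (μ - 1) =
      ∫ s in (0 : ℝ)..s₀, s ^ (μ - 1) * (2 * s * F₁ (s ^ 2)) ^ 2 := by
    refine hcut _ _ (fun s hs ↦ ?_) fun s hs ↦ ?_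
    · rw [hdψ_lt s hs.2, sq_abs, mul_comm]
    · simp [hdψ_gt s hs]
  have hden : ∫ s in (0 : ℝ)..1, |ψ s| ^ 2 * s ^ (μ - 1) =
      ∫ s in (0 : ℝ)..s₀, s ^ (μ - 1) * F (s ^ 2) ^ 2 := by
    refine hcut _ _ (fun s hs ↦ ?_) fun s hs ↦ ?_
    · rw [hψ_lt s hs.2, sq_abs, mul_comm]
    · simp [hψ_gt s hs]
  have hint : ∀ u : ℝ → ℝ, Continuous u →
      IntervalIntegrable (fun s ↦ s ^ (μ - 1) * u s) volume 0 s₀ := fun u hu ↦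
    (intervalIntegral.intervalIntegrable_rpow' (by linarith)).mul_continuousOn hu.continuousOn
  have i1 := hint (fun s ↦ (2 * s * F₁ (s ^ 2)) ^ 2) (by fun_prop)
  have i2 := hint (fun s ↦ F (s ^ 2) ^ 2) (by fun_prop)
  -- Integration by parts of `u'' + (μ-1)/s · u' = -4κ u` against `u s^(μ-1)`. The primitive is
  -- `s^(μ-1) u u'`, written `2 s^μ F F₁`; it vanishes at `0` because `μ > 0` and at `s₀` because
  -- `u(s₀) = 0`.
  have hFTC : ∫ s in (0 : ℝ)..s₀, (s ^ (μ - 1) * (2 * s * F₁ (s ^ 2)) ^ 2 -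
      4 * κ * (s ^ (μ - 1) * F (s ^ 2) ^ 2)) = 0 := by
    have := intervalIntegral.integral_eq_sub_of_hasDerivAt_of_le hs₀0.le
      (f := fun s ↦ s ^ μ * (2 * (F (s ^ 2) * F₁ (s ^ 2))))
      (f' := fun s ↦ s ^ (μ - 1) * (2 * s * F₁ (s ^ 2)) ^ 2 -
        4 * κ * (s ^ (μ - 1) * F (s ^ 2) ^ 2)) ?_ ?_ (i1.sub (i2.const_mul _))
    · rw [this, hs₀F, Real.zero_rpow hμ.ne']
      ring
    · exact ((Real.continuous_rpow_const hμ.le).mul (by fun_prop)).continuousOn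
    · intro s hs
      have hd := (Real.hasDerivAt_rpow_const (p := μ) (Or.inl hs.1.ne')).mul
        (((dFsq s).mul (dF₁sq s)).const_mul 2)
      convert! hd using 1
      have hs1 : s ^ μ = s ^ (μ - 1) * s := by
        rw [← Real.rpow_add_one hs.1.ne', sub_add_cancel]
      rw [hs1]
      simp only [Pi.mul_apply]
      linear_combination (-s ^ (μ - 1) * F (s ^ 2)) * ode (s ^ 2)
  rw [intervalIntegral.integral_sub i1 (i2.const_mul _), intervalIntegral.integral_const_mul] at hFTC
  have hq : modelEigenvalue μ ≤ (∫ s in (0 : ℝ)..1, |deriv ψ s| ^ 2 * s ^ (μ - 1)) /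
      (∫ s in (0 : ℝ)..1, |ψ s| ^ 2 * s ^ (μ - 1)) := by
    refine csInf_le ⟨0, ?_⟩ ⟨ψ, hLip, ?_, ⟨0, by simp, ?_⟩, rfl⟩
    · rintro q ⟨χ, -, -, -, rfl⟩
      refine div_nonneg ?_ ?_ <;>
      · refine intervalIntegral.integral_nonneg zero_le_one fun s hs ↦ ?_
        exact mul_nonneg (sq_nonneg _) (Real.rpow_nonneg hs.1 _)
    · simp only [hψ, min_eq_right hs₀1, hs₀F]
    · simp [hψ, min_eq_left hs₀0.le, hF, hypLimit_zero]
  rw [hnum, hden, sub_eq_zero.1 hFTC] at hq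
  have : 4 * κ * (∫ s in (0 : ℝ)..s₀, s ^ (μ - 1) * F (s ^ 2) ^ 2) /
      (∫ s in (0 : ℝ)..s₀, s ^ (μ - 1) * F (s ^ 2) ^ 2) ≤ 4 * κ := by
    rw [mul_div_assoc]
    -- A quotient `x / x` is at most `1` even for `x = 0`, so the denominator need not be shown
    -- positive.
    exact mul_le_of_le_one_right (by positivity) (div_self_le_one _)
  linarith

/-- A positive, decreasing and convex solution of the model equation, in the variable `t = s²`. -/
theorem exists_model_solution {μ lam r : ℝ} (hμ : 0 < μ) (hlam : 0 < lam)
    (h : lam < modelEigenvalue μ) (hr : 0 < r) :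
    ∃ F F₁ F₂ : ℝ → ℝ, (∀ t, HasDerivAt F (F₁ t) t) ∧ (∀ t, HasDerivAt F₁ (F₂ t) t) ∧
      Continuous F₂ ∧ ∀ t ∈ Icc 0 (r ^ 2), 0 < F t ∧ F₁ t ≤ 0 ∧ 0 ≤ F₂ t ∧
        4 * t * F₂ t + 2 * μ * F₁ t = -(lam / r ^ 2) * F t := by
  have hν : 0 < μ / 2 := by positivity
  have hν1 : 0 < μ / 2 + 1 := by positivity
  have hν2 : 0 < μ / 2 + 1 + 1 := by positivity
  -- The factor `4` comes from the substitution `t = s²`, the factor `r²` from rescaling `[0, 1]` to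
  -- `[0, r²]`.
  set κ := lam / 4 / r ^ 2 with hκ
  have hκ0 : 0 < κ := by positivity
  have hpos : ∀ t ∈ Icc 0 (r ^ 2), 0 < hypLimit (μ / 2) (-κ * t) := by
    intro t ht
    have hr2 : 0 < r ^ 2 := by positivity
    have := hypLimit_pos_of_lt_modelEigenvalue (κ := lam / 4) hμ (by positivity) (by linarith)
      (t / r ^ 2) ⟨div_nonneg ht.1 hr2.le, (div_le_one hr2).2 ht.2⟩
    convert this using 2
    rw [hκ]
    ring
  -- Positivity passes from parameter `μ/2` to the next two; these carry the signs of `F'` and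
  -- `F''`.
  have hpos1 := hypLimit_succ_nonneg hν fun t ht ↦ (hpos t ht).le
  have hpos2 := hypLimit_succ_nonneg hν1 hpos1
  refine ⟨fun t ↦ hypLimit (μ / 2) (-κ * t),
    fun t ↦ -(κ / (μ / 2)) * hypLimit (μ / 2 + 1) (-κ * t),
    fun t ↦ -(κ / (μ / 2)) * (-(κ / (μ / 2 + 1)) * hypLimit (μ / 2 + 1 + 1) (-κ * t)),
    fun t ↦ hasDerivAt_hypLimit_comp hν κ t,
    fun t ↦ (hasDerivAt_hypLimit_comp hν1 κ t).const_mul _, ?_, fun t ht ↦ ⟨hpos t ht, ?_, ?_, ?_⟩⟩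
  · exact continuous_const.mul (continuous_const.mul
      ((continuous_hypLimit hν2).comp (continuous_const.mul continuous_id)))
  · have := mul_nonneg (div_pos hκ0 hν).le (hpos1 t ht)
    linarith
  · have := mul_nonneg (mul_pos (div_pos hκ0 hν) (div_pos hκ0 hν1)).le (hpos2 t ht)
    linarith
  · have hl : lam / r ^ 2 = 4 * κ := by rw [hκ]; ring
    simp only [hl, hypLimit_contiguous hν (-κ * t)]
    field_simp
    ring

end Profile

end ModelEquation

/-! ### Barta's argument and the boundary of the ball. -/

section EigenvalueComparison

open Set Filter Topology

variable {n : ℕ} {M : Type*} [MetricSpace M] [ChartedSpace (EuclideanSpace ℝ (Fin n)) M]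
  [RiemannianBundle (fun x : M ↦ TangentSpace (𝓡 n) x)]
  [IsManifold (𝓡 n) ∞ M]
  [IsContinuousRiemannianBundle (EuclideanSpace ℝ (Fin n)) (fun x : M ↦ TangentSpace (𝓡 n) x)]

variable [MeasurableSpace M] [BorelSpace M] [SecondCountableTopology M]

/-- Off the support of `φ` the product is locally zero whatever `g` does. Regularity of `g` is
therefore needed only at values of `w` on that support, where `-F'/F` is smooth. -/
theorem LipschitzInCharts.sq_mul_comp {φ w : M → ℝ} (hφ : LipschitzInCharts n φ)
    (hw : LipschitzInCharts n w) {g : ℝ → ℝ} (hg : ∀ z ∈ tsupport φ, ContDiffAt ℝ 1 g (w z)) :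
    LipschitzInCharts n fun z ↦ φ z ^ 2 * g (w z) := by
  refine hφ.comp₂ hw fun z ↦ ?_
  by_cases hz : z ∈ tsupport φ
  · exact ⟨fun p ↦ p.1 ^ 2 * g p.2,
      (contDiffAt_fst.pow 2).mul (ContDiffAt.comp (φ z, w z) (hg z hz) contDiffAt_snd),
      EventuallyEq.rfl⟩
  · refine ⟨fun _ ↦ 0, contDiffAt_const, ?_⟩
    filter_upwards [notMem_tsupport_iff_eventuallyEq.1 hz] with a ha
    simp [ha]

theorem ae_inner_riemannianGrad_sq_mul_comp {φ w : M → ℝ} (hφ : LipschitzInCharts n φ)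
    (hw : LipschitzInCharts n w) {g g' : ℝ → ℝ}
    (hg' : ∀ z ∈ tsupport φ, HasDerivAt g (g' (w z)) (w z)) :
    ∀ᵐ z ∂(riemannianVolume n M),
      inner ℝ (riemannianGrad n w z) (riemannianGrad n (fun z ↦ φ z ^ 2 * g (w z)) z) =
        2 * φ z * g (w z) * inner ℝ (riemannianGrad n w z) (riemannianGrad n φ z) +
          φ z ^ 2 * g' (w z) * ‖riemannianGrad n w z‖ ^ 2 := by
  filter_upwards [hφ.ae_mdifferentiableAt, hw.ae_mdifferentiableAt] with z h1 h2
  by_cases hz : z ∈ tsupport φ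
  · rw [riemannianGrad_sq_mul_comp h1 h2 (hg' z hz), inner_add_right, real_inner_smul_right,
      real_inner_smul_right, real_inner_self_eq_norm_sq]
  · have h0 := notMem_tsupport_iff_eventuallyEq.1 hz
    have : (fun z ↦ φ z ^ 2 * g (w z)) =ᶠ[𝓝 z] 0 := by
      filter_upwards [h0] with a ha
      simp [ha]
    rw [riemannianGrad_eq_zero_of_eventuallyEq this, inner_zero_right,
      image_eq_zero_of_notMem_tsupport hz]
    ring

theorem HasCompactSupport.sq_mul {φ v : M → ℝ} (hc : HasCompactSupport φ) :
    HasCompactSupport fun z ↦ φ z ^ 2 * v z :=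
  (hc.comp_left (g := fun t : ℝ ↦ t ^ 2) (by simp)).mul_right

theorem LipschitzInCharts.integrable_sq_mul_comp {φ w : M → ℝ} (hφ : LipschitzInCharts n φ)
    (hw : LipschitzInCharts n w) (hc : HasCompactSupport φ) {g : ℝ → ℝ}
    (hg : ∀ z ∈ tsupport φ, ContDiffAt ℝ 1 g (w z)) :
    Integrable (fun z ↦ φ z ^ 2 * g (w z)) (riemannianVolume n M) :=
  (hφ.sq_mul_comp hw hg).continuous.integrable_of_hasCompactSupport hc.sq_mul

/-- If `Δw ≥ c > 0`, the set where `w` is maximal on the support of `φ` is negligible for `φ²`. -/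
theorem WeakLaplacianGE.ae_eq_zero_of_isMax {w φ : M → ℝ} {c m : ℝ} (hc0 : 0 < c)
    (hweak : WeakLaplacianGE n w fun _ ↦ c) (hw : LipschitzInCharts n w)
    (hφ : LipschitzInCharts n φ) (hc : HasCompactSupport φ)
    (hmax : ∀ z ∈ tsupport φ, w z ≤ m) :
    ∀ᵐ z ∂(riemannianVolume n M), w z = m → φ z = 0 := by
  classical
  set V := riemannianVolume n M
  -- These weights are nondecreasing, at most `1` on the support of `φ`, and tend to the indicator
  -- of `{w = m}`. They are used in the test functions `φ² G k (w)`.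
  set G : ℕ → ℝ → ℝ := fun k t ↦ Real.exp (k * (t - m)) with hG
  set G' : ℕ → ℝ → ℝ := fun k t ↦ k * Real.exp (k * (t - m)) with hG'
  have hGd : ∀ k z, HasDerivAt (G k) (G' k (w z)) (w z) := fun k z ↦ by
    have := (((hasDerivAt_id (w z)).sub_const m).const_mul (k : ℝ)).exp
    convert! this using 1
    simp [hG']
    ring
  have hGc : ∀ k, ContDiff ℝ 1 (G k) := fun k ↦
    (contDiff_const.mul (contDiff_id.sub contDiff_const)).exp
  have hG1 : ∀ k, ∀ z ∈ tsupport φ, G k (w z) ≤ 1 := fun k z hz ↦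
    Real.exp_le_one_iff.2 (mul_nonpos_of_nonneg_of_nonpos k.cast_nonneg
      (sub_nonpos.2 (hmax z hz)))
  have hGlim : ∀ z ∈ tsupport φ,
      Tendsto (fun k ↦ G k (w z)) atTop (𝓝 (if w z = m then 1 else 0)) := by
    intro z hz
    split_ifs with h
    · simp [hG, h]
    · have hlt : w z - m < 0 := sub_neg.2 (lt_of_le_of_ne (hmax z hz) h)
      exact Real.tendsto_exp_atBot.comp
        (tendsto_natCast_atTop_atTop.atTop_mul_const_of_neg hlt)
  set X : M → ℝ := fun z ↦ 2 * φ z * inner ℝ (riemannianGrad n w z) (riemannianGrad n φ z) with hX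
  have hφc : Continuous φ := hφ.continuous
  have hwc : Continuous w := hw.continuous
  have hXint : Integrable X V := by
    have h1 : LipschitzInCharts n fun z ↦ φ z ^ 2 * (fun _ : ℝ ↦ (1 : ℝ)) (w z) :=
      hφ.sq_mul_comp hw fun _ _ ↦ contDiffAt_const
    refine (hw.integrable_inner_riemannianGrad h1 hc.sq_mul).congr ?_
    filter_upwards [ae_inner_riemannianGrad_sq_mul_comp (g' := fun _ ↦ 0) hφ hw
      (fun z _ ↦ hasDerivAt_const (w z) (1 : ℝ))] with z hz
    rw [hz, hX]
    ring
  have hφ2int : Integrable (fun z ↦ φ z ^ 2) V := by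
    simpa using hφ.integrable_sq_mul_comp hw hc (g := fun _ ↦ 1) fun _ _ ↦ contDiffAt_const
  have hXG : ∀ k z, ‖X z * G k (w z)‖ ≤ ‖X z‖ := fun k z ↦ by
    by_cases hz : z ∈ tsupport φ
    · rw [norm_mul, Real.norm_of_nonneg (Real.exp_pos _).le]
      exact mul_le_of_le_one_right (norm_nonneg _) (hG1 k z hz)
    · simp [hX, image_eq_zero_of_notMem_tsupport hz]
  have hφG : ∀ k z, ‖φ z ^ 2 * G k (w z)‖ ≤ φ z ^ 2 := fun k z ↦ by
    by_cases hz : z ∈ tsupport φ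
    · rw [norm_mul, Real.norm_of_nonneg (Real.exp_pos _).le, Real.norm_of_nonneg (sq_nonneg _)]
      exact mul_le_of_le_one_right (sq_nonneg _) (hG1 k z hz)
    · simp [image_eq_zero_of_notMem_tsupport hz]
  have hmeasG : ∀ k, AEStronglyMeasurable (fun z ↦ G k (w z)) V := fun k ↦
    ((hGc k).continuous.comp hwc).aestronglyMeasurable
  have hXGint : ∀ k, Integrable (fun z ↦ X z * G k (w z)) V := fun k ↦
    hXint.mono (hXint.aestronglyMeasurable.mul (hmeasG k)) (Eventually.of_forall (hXG k))
  -- The term of the pairing that contains `G'` is nonnegative and is discarded.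
  have hle : ∀ k, ∫ z, X z * G k (w z) ∂V ≤ -(c * ∫ z, φ z ^ 2 * G k (w z) ∂V) := by
    intro k
    have hζ := hφ.sq_mul_comp hw (g := G k) fun z _ ↦ (hGc k).contDiffAt
    rw [← integral_const_mul]
    refine le_trans (integral_mono_ae (hXGint k)
      (hw.integrable_inner_riemannianGrad hζ hc.sq_mul) ?_)
      (hweak.integral_le hw hζ hc.sq_mul fun z ↦ mul_nonneg (sq_nonneg _) (Real.exp_pos _).le)
    filter_upwards [ae_inner_riemannianGrad_sq_mul_comp hφ hw (g := G k) (g' := G' k)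
      fun z _ ↦ hGd k z] with z hz
    rw [hz, hX]
    have : 0 ≤ φ z ^ 2 * G' k (w z) * ‖riemannianGrad n w z‖ ^ 2 :=
      mul_nonneg (mul_nonneg (sq_nonneg _) (mul_nonneg k.cast_nonneg (Real.exp_pos _).le))
        (sq_nonneg _)
    linarith
  have hlim1 : Tendsto (fun k ↦ ∫ z, X z * G k (w z) ∂V) atTop (𝓝 (∫ _, (0 : ℝ) ∂V)) := by
    refine tendsto_integral_of_dominated_convergence (fun z ↦ ‖X z‖)
      (fun k ↦ (hXGint k).aestronglyMeasurable) hXint.norm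
      (fun k ↦ Eventually.of_forall (hXG k)) (Eventually.of_forall fun z ↦ ?_)
    by_cases h0 : φ z = 0
    · simp [hX, h0]
    have hzs : z ∈ tsupport φ := subset_closure h0
    by_cases hzm : w z = m
    · have hext : IsLocalExtr w z := by
        right
        filter_upwards [(isOpen_ne_fun hφc continuous_const).mem_nhds h0] with a ha
        rw [hzm]
        exact hmax a (subset_closure ha)
      simp [hX, hext.riemannianGrad_eq_zero]
    · have := (hGlim z hzs).const_mul (X z)
      simpa [hzm] using this
  have hlim2 : Tendsto (fun k ↦ ∫ z, φ z ^ 2 * G k (w z) ∂V) atTop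
      (𝓝 (∫ z, φ z ^ 2 * (if w z = m then 1 else 0) ∂V)) := by
    refine tendsto_integral_of_dominated_convergence (fun z ↦ φ z ^ 2)
      (fun k ↦ (hφc.pow 2).aestronglyMeasurable.mul (hmeasG k)) hφ2int
      (fun k ↦ Eventually.of_forall (hφG k)) (Eventually.of_forall fun z ↦ ?_)
    by_cases hz : z ∈ tsupport φ
    · exact (hGlim z hz).const_mul _
    · simp [image_eq_zero_of_notMem_tsupport hz]
  have hfin := le_of_tendsto_of_tendsto' hlim1 (hlim2.const_mul c).neg hle
  rw [integral_zero] at hfin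
  have hnn : 0 ≤ fun z ↦ φ z ^ 2 * (if w z = m then (1 : ℝ) else 0) := fun z ↦ by
    dsimp only [Pi.zero_apply]
    positivity
  have hset : MeasurableSet {z | w z = m} := (isClosed_singleton.preimage hwc).measurableSet
  have hint : Integrable (fun z ↦ φ z ^ 2 * (if w z = m then (1 : ℝ) else 0)) V := by
    refine (hφ2int.indicator hset).congr (Eventually.of_forall fun z ↦ ?_)
    by_cases h : w z = m <;> simp [h]
  have h0 : ∫ z, φ z ^ 2 * (if w z = m then (1 : ℝ) else 0) ∂V = 0 :=
    le_antisymm (by nlinarith) (integral_nonneg hnn)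
  filter_upwards [(integral_eq_zero_iff_of_nonneg hnn hint).1 h0] with z hz hzm
  simpa [hzm] using hz

/-- Barta's argument with the radial solution of the model equation. -/
theorem WeakLaplacianGE.integral_sq_le {w φ : M → ℝ} {μ lam r : ℝ} (hμ : 0 < μ) (hlam : 0 < lam)
    (h : lam < modelEigenvalue μ) (hr : 0 < r) (hweak : WeakLaplacianGE n w fun _ ↦ 2 * μ)
    (hw : LipschitzInCharts n w) (hw0 : ∀ z, 0 ≤ w z)
    (hgrad : ∀ᵐ z ∂(riemannianVolume n M), ‖riemannianGrad n w z‖ ^ 2 ≤ 4 * w z)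
    (hφ : LipschitzInCharts n φ) (hc : HasCompactSupport φ)
    (hsupp : ∀ z ∈ tsupport φ, w z ≤ r ^ 2) :
    lam / r ^ 2 * ∫ z, φ z ^ 2 ∂(riemannianVolume n M) ≤
      ∫ z, ‖riemannianGrad n φ z‖ ^ 2 ∂(riemannianVolume n M) := by
  obtain ⟨F, F₁, F₂, dF, dF₁, cF₂, hF⟩ := exists_model_solution hμ hlam h hr
  have hF' : ∀ z ∈ tsupport φ, _ := fun z hz ↦ hF (w z) ⟨hw0 z, hsupp z hz⟩
  have smooth : ∀ f f' : ℝ → ℝ, (∀ t, HasDerivAt f (f' t) t) → Continuous f' → ContDiff ℝ 1 f := by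
    intro f f' hf hf'
    refine contDiff_one_iff_deriv.2 ⟨fun t ↦ (hf t).differentiableAt, ?_⟩
    rwa [show deriv f = f' from funext fun t ↦ (hf t).deriv]
  have sF : ContDiff ℝ 1 F := smooth F F₁ dF
    (continuous_iff_continuousAt.2 fun t ↦ (dF₁ t).continuousAt)
  have sF₁ : ContDiff ℝ 1 F₁ := smooth F₁ F₂ dF₁ cF₂
  -- Minus the logarithmic derivative of `F`; it satisfies the Riccati identity `g' = -F''/F + g²`.
  set g : ℝ → ℝ := fun t ↦ -F₁ t / F t with hg
  set g' : ℝ → ℝ := fun t ↦ -F₂ t / F t + g t ^ 2 with hg'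
  have hgc : ∀ z ∈ tsupport φ, ContDiffAt ℝ 1 g (w z) := fun z hz ↦
    sF₁.contDiffAt.neg.div sF.contDiffAt (hF' z hz).1.ne'
  have hgd : ∀ z ∈ tsupport φ, HasDerivAt g (g' (w z)) (w z) := fun z hz ↦ by
    have := (hF' z hz).1.ne'
    convert! ((dF₁ (w z)).neg).div (dF (w z)) this using 1
    simp only [hg', hg, Pi.neg_apply]
    field_simp
    ring
  have hζ := hφ.sq_mul_comp hw hgc
  have hpos : ∀ z, 0 ≤ φ z ^ 2 * g (w z) := fun z ↦ by
    by_cases hz : z ∈ tsupport φ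
    · exact mul_nonneg (sq_nonneg _)
        (div_nonneg (neg_nonneg.2 (hF' z hz).2.1) (hF' z hz).1.le)
    · simp [image_eq_zero_of_notMem_tsupport hz]
  have key := hweak.integral_le hw hζ hc.sq_mul hpos
  have iζ := (hφ.integrable_sq_mul_comp hw hc hgc).const_mul (2 * μ)
  have iφ : Integrable (fun z ↦ φ z ^ 2) (riemannianVolume n M) := by
    simpa using hφ.integrable_sq_mul_comp hw hc (g := fun _ ↦ 1) fun _ _ ↦ contDiffAt_const
  have iD : Integrable (fun z ↦ ‖riemannianGrad n φ z‖ ^ 2) (riemannianVolume n M) := by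
    simpa only [real_inner_self_eq_norm_sq] using hφ.integrable_inner_riemannianGrad hφ hc
  have iζg := hw.integrable_inner_riemannianGrad hζ hc.sq_mul
  have hpt : ∀ᵐ z ∂(riemannianVolume n M), lam / r ^ 2 * φ z ^ 2 ≤
      ‖riemannianGrad n φ z‖ ^ 2 + (inner ℝ (riemannianGrad n w z)
        (riemannianGrad n (fun z ↦ φ z ^ 2 * g (w z)) z) + 2 * μ * (φ z ^ 2 * g (w z))) := by
    filter_upwards [ae_inner_riemannianGrad_sq_mul_comp hφ hw hgd, hgrad] with z hz hgz
    rw [hz]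
    by_cases hzs : z ∈ tsupport φ
    · obtain ⟨f0, f1, f2, ode⟩ := hF' z hzs
      -- This square absorbs the cross term and the `g²` part of `g'`. The remaining `-F''/F ·
      -- |∇w|²` is compared with `4w` using `F'' ≥ 0`, and the model equation then produces `lam / r
      -- ^ 2`.
      have hsq : 0 ≤ ‖riemannianGrad n φ z + (φ z * g (w z)) • riemannianGrad n w z‖ ^ 2 :=
        sq_nonneg _
      rw [norm_add_sq_real, real_inner_smul_right, norm_smul, mul_pow, Real.norm_eq_abs, sq_abs,
        real_inner_comm] at hsq
      have h1 : φ z ^ 2 * (F₂ (w z) / F (w z)) * ‖riemannianGrad n w z‖ ^ 2 ≤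
          φ z ^ 2 * (F₂ (w z) / F (w z)) * (4 * w z) :=
        mul_le_mul_of_nonneg_left hgz (mul_nonneg (sq_nonneg _) (div_nonneg f2 f0.le))
      have h2 : lam / r ^ 2 * φ z ^ 2 =
          -(φ z ^ 2 * (F₂ (w z) / F (w z)) * (4 * w z)) + 2 * μ * (φ z ^ 2 * g (w z)) := by
        have : lam / r ^ 2 = -(4 * w z * F₂ (w z) + 2 * μ * F₁ (w z)) / F (w z) := by
          rw [ode, eq_div_iff f0.ne']
          ring
        rw [this]
        simp only [hg]
        field_simp
        ring
      have h3 : φ z ^ 2 * g' (w z) * ‖riemannianGrad n w z‖ ^ 2 =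
          -(φ z ^ 2 * (F₂ (w z) / F (w z)) * ‖riemannianGrad n w z‖ ^ 2) +
            (φ z * g (w z)) ^ 2 * ‖riemannianGrad n w z‖ ^ 2 := by
        simp only [hg']
        ring
      rw [h2, h3]
      linarith
    · rw [image_eq_zero_of_notMem_tsupport hzs]
      simp
  have := integral_mono_ae (iφ.const_mul _) (iD.add (iζg.add iζ)) hpt
  rw [integral_const_mul, integral_add' iD (iζg.add iζ), integral_add' iζg iζ] at this
  linarith

/-- Convert the inequality of integrals into a bound for the Rayleigh quotient. -/
theorem ofReal_le_rayleigh {φ : M → ℝ} {Ω : Set M} {a : ℝ} (ha : 0 ≤ a) (hΩ : IsOpen Ω)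
    (hφ : LipschitzInCharts n φ) (hc : HasCompactSupport φ) (hs : tsupport φ ⊆ closure Ω)
    (hne : ∃ x, φ x ≠ 0) (hout : ∀ᵐ z ∂(riemannianVolume n M), z ∉ Ω → φ z = 0)
    (h : a * ∫ z, |φ z| ^ 2 ∂(riemannianVolume n M) ≤
      ∫ z, ‖riemannianGrad n (fun z ↦ |φ z|) z‖ ^ 2 ∂(riemannianVolume n M))
    (hφabs : LipschitzInCharts n fun z ↦ |φ z|) :
    ENNReal.ofReal a ≤ (∫⁻ x in Ω, ‖riemannianGrad n φ x‖ₑ ^ 2 ∂(riemannianVolume n M)) /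
      (∫⁻ x in Ω, ‖φ x‖ₑ ^ 2 ∂(riemannianVolume n M)) := by
  classical
  set V := riemannianVolume n M
  have : V.IsOpenPosMeasure := isOpenPosMeasure_riemannianVolume
  have hφc : Continuous φ := hφ.continuous
  have habs : HasCompactSupport fun z ↦ |φ z| := hc.comp_left (g := fun t : ℝ ↦ |t|) abs_zero
  have iφ : Integrable (fun z ↦ |φ z| ^ 2) V :=
    Continuous.integrable_of_hasCompactSupport (hφabs.continuous.pow 2)
      (habs.comp_left (g := fun t : ℝ ↦ t ^ 2) (by simp))
  have iD : Integrable (fun z ↦ ‖riemannianGrad n (fun z ↦ |φ z|) z‖ ^ 2) V := by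
    simpa only [real_inner_self_eq_norm_sq] using hφabs.integrable_inner_riemannianGrad hφabs habs
  have e1 : ENNReal.ofReal (∫ z, |φ z| ^ 2 ∂V) = ∫⁻ z, ‖φ z‖ₑ ^ 2 ∂V := by
    rw [ofReal_integral_eq_lintegral_ofReal iφ (Eventually.of_forall fun z ↦ sq_nonneg _)]
    refine lintegral_congr fun z ↦ ?_
    rw [ENNReal.ofReal_pow (abs_nonneg _), Real.enorm_eq_ofReal_abs]
  -- The gradient of `|φ|` vanishes at every zero of `φ`, so only `Ω` contributes up to a null set.
  -- The gradient of `φ` itself need not vanish there, hence the passage to `|φ|`.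
  have e2 : ENNReal.ofReal (∫ z, ‖riemannianGrad n (fun z ↦ |φ z|) z‖ ^ 2 ∂V) ≤
      ∫⁻ x in Ω, ‖riemannianGrad n φ x‖ₑ ^ 2 ∂V := by
    rw [ofReal_integral_eq_lintegral_ofReal iD (Eventually.of_forall fun z ↦ sq_nonneg _),
      ← lintegral_indicator hΩ.measurableSet]
    refine lintegral_mono_ae ?_
    filter_upwards [hout] with z hz
    by_cases hzΩ : z ∈ Ω
    · rw [indicator_of_mem hzΩ, ENNReal.ofReal_pow (norm_nonneg _), ofReal_norm]
      gcongr
      exact enorm_le_iff_norm_le.2 (norm_riemannianGrad_abs_le hφc.continuousAt)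
    · have : IsLocalExtr (fun z ↦ |φ z|) z :=
        Or.inl (Eventually.of_forall fun y ↦ by simp [hz hzΩ])
      simp [this.riemannianGrad_eq_zero]
  have hden_top : ∫⁻ x in Ω, ‖φ x‖ₑ ^ 2 ∂V ≠ ⊤ :=
    ((setLIntegral_le_lintegral _ _).trans_lt (e1 ▸ ENNReal.ofReal_lt_top)).ne
  -- The open set `{φ ≠ 0}` meets the closure of `Ω`, hence `Ω`, in a nonempty open set, which has
  -- positive volume.
  have hden_zero : ∫⁻ x in Ω, ‖φ x‖ₑ ^ 2 ∂V ≠ 0 := by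
    obtain ⟨x, hx⟩ := hne
    have hU : IsOpen {x | φ x ≠ 0} := isOpen_ne_fun hφc continuous_const
    obtain ⟨y, hy, hyΩ⟩ := mem_closure_iff.1 (hs (subset_closure hx)) _ hU hx
    intro h0
    rw [lintegral_eq_zero_iff (by fun_prop), EventuallyEq, ae_restrict_iff' hΩ.measurableSet,
      ae_iff] at h0
    have hpos : 0 < V (_ ∩ Ω) := (hU.inter hΩ).measure_pos V ⟨y, hy, hyΩ⟩
    refine hpos.ne' (measure_mono_null ?_ h0)
    rintro a ⟨ha1, ha2⟩
    simpa [ha2] using! ha1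
  rw [ENNReal.le_div_iff_mul_le (Or.inl hden_zero) (Or.inl hden_top)]
  calc ENNReal.ofReal a * ∫⁻ x in Ω, ‖φ x‖ₑ ^ 2 ∂V
      ≤ ENNReal.ofReal a * ∫⁻ x, ‖φ x‖ₑ ^ 2 ∂V := by
        gcongr
        exact Measure.restrict_le_self
    _ = ENNReal.ofReal (a * ∫ z, |φ z| ^ 2 ∂V) := by rw [← e1, ENNReal.ofReal_mul ha]
    _ ≤ _ := (ENNReal.ofReal_le_ofReal h).trans e2

end EigenvalueComparison

/-! ### Second countability from the exhaustion, and the conclusion. -/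

theorem secondCountableTopology_of_exhaustion {M : Type*} [MetricSpace M] {ρ : M → ℝ}
    (h : ∀ r : ℝ, 0 < r → IsCompact (closure {x | ρ x < r})) : SecondCountableTopology M := by
  have : SigmaCompactSpace M := by
    refine ⟨⟨fun k : ℕ ↦ closure {x | ρ x < k + 1}, fun k ↦ h _ (by positivity), ?_⟩⟩
    refine Set.eq_univ_of_forall fun x ↦ ?_
    obtain ⟨k, hk⟩ := exists_nat_gt (ρ x)
    exact Set.mem_iUnion.2 ⟨k, subset_closure (show ρ x < k + 1 by linarith)⟩
  infer_instance

theorem proposition1p5 {n : ℕ} (hn : 2 ≤ n)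
    {M : Type*} [MetricSpace M] [ChartedSpace (EuclideanSpace ℝ (Fin n)) M]
    [IsManifold (𝓡 n) ∞ M]
    [RiemannianBundle (fun x : M ↦ TangentSpace (𝓡 n) x)]
    [IsContMDiffRiemannianBundle (𝓡 n) ∞ (EuclideanSpace ℝ (Fin n))
      (fun x : M ↦ TangentSpace (𝓡 n) x)]
    [IsRiemannianManifold (𝓡 n) M]
    [CompleteSpace M] [NoncompactSpace M]
    [MeasurableSpace M] [BorelSpace M]
    (μ : ℝ) (hμ : 0 < μ)
    (ρ : M → ℝ) (hρ_nonneg : ∀ x, 0 ≤ ρ x) (hρ_lip : LocallyLipschitz ρ)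
    (hρ_exh : ∀ r : ℝ, 0 < r → IsCompact (closure {x | ρ x < r}))
    (hρ_grad : ∀ᵐ x ∂(riemannianVolume n M), ‖riemannianGrad n ρ x‖ ≤ 1)
    (hρ_lap : WeakLaplacianGE n (fun x ↦ ρ x ^ 2) (fun _ ↦ 2 * μ)) :
    ∀ r : ℝ, 0 < r →
      ENNReal.ofReal (modelEigenvalue μ / r ^ 2)
        ≤ firstDirichletEigenvalue n {x | ρ x < r} := by
  intro r hr
  have : IsContMDiffRiemannianBundle (𝓡 n) 0 (EuclideanSpace ℝ (Fin n))
      (fun x : M ↦ TangentSpace (𝓡 n) x) :=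
    IsContMDiffRiemannianBundle.of_le (n := ∞) bot_le
  have : IsContinuousRiemannianBundle (EuclideanSpace ℝ (Fin n))
      (fun x : M ↦ TangentSpace (𝓡 n) x) := by
    obtain ⟨g, hg, h⟩ := IsContMDiffRiemannianBundle.exists_contMDiff (IB := 𝓡 n) (n := 0)
      (F := EuclideanSpace ℝ (Fin n)) (E := fun x : M ↦ TangentSpace (𝓡 n) x)
    exact ⟨⟨g, hg.continuous, h⟩⟩
  have := secondCountableTopology_of_exhaustion hρ_exh
  have hρ := hρ_lip.lipschitzInCharts (n := n)
  have hρc : Continuous ρ := hρ.continuous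
  have hΩ : IsOpen {x | ρ x < r} := isOpen_lt hρc continuous_const
  have hw : LipschitzInCharts n fun x ↦ ρ x ^ 2 := by
    simpa only [sq] using hρ.mul hρ
  have hgrad : ∀ᵐ z ∂(riemannianVolume n M),
      ‖riemannianGrad n (fun x ↦ ρ x ^ 2) z‖ ^ 2 ≤ 4 * ρ z ^ 2 := by
    filter_upwards [hρ_grad, hρ.ae_mdifferentiableAt] with z h1 h2
    rw [riemannianGrad_sq h2, norm_smul, mul_pow, Real.norm_eq_abs, sq_abs, mul_pow]
    have : ‖riemannianGrad n ρ z‖ ^ 2 ≤ 1 := pow_le_one₀ (norm_nonneg _) h1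
    nlinarith [sq_nonneg (ρ z)]
  have hcl : closure {x | ρ x < r} ⊆ {x | ρ x ≤ r} :=
    closure_minimal (fun x hx ↦ le_of_lt (show ρ x < r from hx)) (isClosed_le hρc continuous_const)
  unfold firstDirichletEigenvalue
  refine le_iInf fun φ ↦ le_iInf fun ⟨K, hK⟩ ↦ le_iInf fun hc ↦ le_iInf fun hs ↦ le_iInf fun hne ↦ ?_
  have hφ := hK.locallyLipschitz.lipschitzInCharts (n := n)
  have hφabs : LipschitzInCharts n fun z ↦ |φ z| :=
    LocallyLipschitz.lipschitzInCharts (lipschitzWith_one_norm.comp hK).locallyLipschitz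
  have hcabs : HasCompactSupport fun z ↦ |φ z| := hc.comp_left (g := fun t : ℝ ↦ |t|) abs_zero
  have hmax : ∀ z ∈ tsupport φ, ρ z ^ 2 ≤ r ^ 2 := fun z hz ↦
    pow_le_pow_left₀ (hρ_nonneg z) (hcl (hs hz)) 2
  have hmaxabs : ∀ z ∈ tsupport fun z ↦ |φ z|, ρ z ^ 2 ≤ r ^ 2 := fun z hz ↦
    hmax z (closure_mono (s := Function.support fun z ↦ |φ z|) (t := Function.support φ)
      (fun y hy h0 ↦ hy (by simp [h0])) hz)
  -- On its support `φ` satisfies `ρ ≤ r`, so outside the ball it can be nonzero only where `ρ² =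
  -- r²`, the maximal value allowed there.
  have hout : ∀ᵐ z ∂(riemannianVolume n M), z ∉ {x | ρ x < r} → φ z = 0 := by
    filter_upwards [hρ_lap.ae_eq_zero_of_isMax (by positivity) hw hφ hc hmax] with z hz hzr
    by_contra h0
    have h1 : ρ z ≤ r := hcl (hs (subset_closure h0))
    exact h0 (hz (by rw [le_antisymm h1 (not_lt.1 hzr)]))
  have hlam : ∀ lam, 0 < lam → lam < modelEigenvalue μ → ENNReal.ofReal (lam / r ^ 2) ≤
      (∫⁻ x in {x | ρ x < r}, ‖riemannianGrad n φ x‖ₑ ^ 2 ∂(riemannianVolume n M)) /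
        (∫⁻ x in {x | ρ x < r}, ‖φ x‖ₑ ^ 2 ∂(riemannianVolume n M)) := fun lam h0 h1 ↦
    ofReal_le_rayleigh (by positivity) hΩ hφ hc hs hne hout
      (hρ_lap.integral_sq_le hμ h0 h1 hr hw (fun z ↦ sq_nonneg _) hgrad hφabs hcabs hmaxabs) hφabs
  -- If `modelEigenvalue μ ≤ 0` the bound is trivial. Otherwise the estimate holds for each `lam`
  -- strictly below it, which keeps `F` positive up to `t = r²`, and passes to the limit.
  rcases le_or_gt (modelEigenvalue μ) 0 with hle | hlt
  · rw [ENNReal.ofReal_of_nonpos (div_nonpos_of_nonpos_of_nonneg hle (sq_nonneg r))]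
    exact bot_le
  · have hcont : Filter.Tendsto (fun lam ↦ ENNReal.ofReal (lam / r ^ 2))
        (nhdsWithin (modelEigenvalue μ) (Set.Iio (modelEigenvalue μ)))
        (nhds (ENNReal.ofReal (modelEigenvalue μ / r ^ 2))) :=
      (ENNReal.continuous_ofReal.comp (continuous_id.div_const _)).continuousWithinAt
    refine le_of_tendsto hcont ?_
    filter_upwards [self_mem_nhdsWithin, mem_nhdsWithin_of_mem_nhds (lt_mem_nhds hlt)] with lam h1 h2
    exact hlam lam h2 h1
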